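/- Let $k$ be a field, $n\ge 0$, $q\in k^\times$, and let $r_{ij}\in k^\times$ be given for $1\le i<j\le n$ (no relation between the $r_{ij}$ is needed). Put $\mu=q-q^{-1}$, $\theta_{ij}=1$ if $i>j$ and $\theta_{ij}=0$ otherwise, and let $R$ be the multiparameter Hecke $R$-matrix $$R^i{}_k{}^j{}_l=\delta^i{}_k\delta^j{}_lM_{ij}+\delta^i{}_l\delta^j{}_kL_{ij},\qquad M_{ij}=q\delta_{ij}+\theta_{ji}\frac{q}{r_{ij}}+\theta_{ij}\frac{r_{ji}}{q},\qquad L_{ij}=\theta_{ji}\mu .$$ Then $R$ and its transpose $R^{t_2}$ in the second tensor factor are invertible; let $\tilde R=((R^{t_2})^{-1})^{t_2}$. (Repeated indices are summed below, except the free indices in the list of relations.) Let $\mathcal L=\widetilde{sl_q(n)}$ be the vector space with basis $X^i{}_j$, $1\le i,j\le n$, with the coproduct $\Delta X^i{}_j=X^i{}_a\otimes X^a{}_j$, the braiding $$\Psi(X^i{}_j\otimes X^k{}_l)=R^i{}_b{}^a{}_o\,R^{-1}{}^b{}_m{}^p{}_d\,R^s{}_c{}^d{}_l\,\tilde R^c{}_j{}^k{}_a\;X^o{}_p\otimes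 X^m{}_s$$ and the braided Lie bracket $$[X^i{}_j,X^k{}_l]=R^{-1}{}^a{}_m{}^i{}_b\,R^s{}_c{}^b{}_o\,R^o{}_d{}^c{}_l\,\tilde R^d{}_j{}^k{}_a\;X^m{}_s .$$ Let $\Upsilon=([\ ,\ ]\otimes\mathrm{id})(\mathrm{id}\otimes\Psi)(\Delta\otimes\mathrm{id})$ be its canonical braiding, and let $B(\mathcal L)=T(\mathcal L)/\langle \mathrm{im}(\mathrm{id}-\Upsilon)\rangle$ be its braided enveloping algebra. Then $$\Upsilon(X^i{}_j\otimes X^k{}_l)=R^{-1}{}^a{}_m{}^i{}_b\,R^s{}_c{}^b{}_o\,R^p{}_d{}^c{}_l\,\tilde R^d{}_j{}^k{}_a\;X^m{}_s\otimes X^o{}_p .$$ For distinct $i,j,k$ let $\sigma$ be the permutation of $\{i,j,k\}$ with $\sigma(i)>\sigma(j)>\sigma(k)$ and put $$\sigma_{ijk}=\left(\frac{q\,r_{\sigma(k)\sigma(i)}}{r_{\sigma(j)\sigma(i)}\,r_{\sigma(k)\sigma(j)}}\right)^{\mathrm{sign}(\sigma)};$$ $\bar\sigma_{ijk}$ is the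 same expression with $q$ and all $r_{ij}$ inverted. Consider the following relations, in which different letters among $i,j,k,l$ denote distinct indices. (i) For $i<k$: $X^i{}_iX^k{}_k=X^k{}_kX^i{}_i$. (ii.a) For $k,l>i$: $X^i{}_iX^k{}_l=X^k{}_lX^i{}_i$. (ii.b) For $i>k,l$: $X^i{}_iX^k{}_l=X^k{}_lX^i{}_i$. (ii.c) For $l>i>k$: $X^i{}_iX^k{}_l-X^k{}_lX^i{}_i=-\mu\bar\sigma_{kil}X^i{}_lX^k{}_i$. (ii.d) For $k>i>l$: $X^i{}_iX^k{}_l-X^k{}_lX^i{}_i=\mu\bar\sigma_{ilk}X^i{}_lX^k{}_i$. (ii.e) For $i<l$: $X^i{}_iX^i{}_l-q^{-2}X^i{}_lX^i{}_i=-q^{-1}\mu\sum_{a<i}X^i{}_aX^a{}_l$. (ii.f) For $i>l$: $X^i{}_iX^i{}_l-X^i{}_lX^i{}_i=-q^{-1}\mu\sum_{a<i}X^i{}_aX^a{}_l$. (ii.g) For $i>k$: $X^i{}_iX^k{}_i-X^k{}_iX^i{}_i=\mu q^{-1}\sum_{a<i}X^k{}_aX^a{}_i$. (ii.h) For $i<k$: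 $X^i{}_iX^k{}_i-q^2X^k{}_iX^i{}_i=\mu q\sum_{a<i}X^k{}_aX^a{}_i$. (iii.a) For $i<k$: $X^i{}_jX^k{}_l-\sigma_{ijk}\bar\sigma_{ijl}X^k{}_lX^i{}_j=\mu\theta_{jl}\sigma_{ijk}X^k{}_jX^i{}_l$. (iii.b) For $j<l$: $qX^i{}_jX^i{}_l=\bar\sigma_{ijl}X^i{}_lX^i{}_j$. (iii.c) For $i<k$: $X^i{}_jX^k{}_j=q\sigma_{ijk}X^k{}_jX^i{}_j$. (iii.d) For $i<j$: $qX^i{}_jX^j{}_l-\bar\sigma_{jli}X^j{}_lX^i{}_j=-\mu\sum_{a<j}X^i{}_aX^a{}_l+\mu\theta_{jl}X^j{}_jX^i{}_l$. (iii.e) For $i<k$: $\bar\sigma_{ijk}X^i{}_jX^k{}_i-qX^k{}_iX^i{}_j=\mu\sum_{a<i}X^k{}_aX^a{}_j+\mu\theta_{ji}X^k{}_jX^i{}_i$. (iii.f) For $i<j$: $$X^i{}_jX^j{}_i-X^j{}_iX^i{}_j=q\mu\sum_{a<i}q^{2(a-i)}X^a{}_jX^j{}_a+q^{-1}\mu X^j{}_jX^i{}_i-q^{-1}\mu\sum_{a<j}X^i{}_aX^a{}_i+\mu^2\sum_{b<j,\,a<i}q^{2(a-i)}X^a{}_bX^b{}_a-\mu^2X^j{}_j\sum_{a<i}q^{2(a-i)}X^a{}_a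 .$$ These are exactly $\binom{n^2}{2}$ relations. The corresponding elements (left-hand side minus right-hand side) of $\mathcal L\otimes\mathcal L$ are linearly independent and span $\mathrm{im}(\mathrm{id}-\Upsilon)$. All of them hold in $B(\mathcal L)$, and they are defining relations of $B(\mathcal L)$: elements $Y^i{}_j$ of a unital associative $k$-algebra $A$ satisfy them if and only if there is a unique algebra homomorphism $B(\mathcal L)\to A$ with $X^i{}_j\mapsto Y^i{}_j$. Moreover, elements $Y^i{}_j$ of $A$ satisfy them if and only if they satisfy the defining relation $R_{21}Y_1R\,Y_2=Y_2\,R_{21}Y_1R$ of the braided matrix algebra $BM_q(n)$, so that $B(\mathcal L)=BM_q(n)$. -/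

import Mathlib

open scoped TensorProduct Kronecker

noncomputable section

namespace BraidedMatrix

variable {𝕜 : Type*} [Field 𝕜] {n : ℕ}

/-! ### R-matrices

A tensor `T^i_k^j_l` (that is, `T` acting on `V ⊗ V`, first factor `i,k`, second factor `j,l`) is
stored as the matrix with entry `T (i, j) (k, l)`. -/

/-- Matrices acting on `V ⊗ V`, where `V` has a basis indexed by `Fin n`. -/
abbrev RMat (𝕜 : Type*) (n : ℕ) := Matrix (Fin n × Fin n) (Fin n × Fin n) 𝕜

/-- The entry `T^i_k^j_l`. -/
def ent (T : RMat 𝕜 n) (i k j l : Fin n) : 𝕜 := T (i, j) (k, l)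

/-- Transposition in the second tensor factor: `(T^{t₂})^i_k^l_j = T^i_k^j_l`. -/
def transpose₂ (T : RMat 𝕜 n) : RMat 𝕜 n := fun x y => T (x.1, y.2) (y.1, x.2)

/-- The second inverse `R̃ = ((R^{t₂})⁻¹)^{t₂}`; when `R^{t₂}` is invertible it is determined by
`∑ R^i_b^a_l R̃^b_j^k_a = δ^i_j δ^k_l = ∑ R̃^i_b^a_l R^b_j^k_a`. -/
def secondInv (R : RMat 𝕜 n) : RMat 𝕜 n := transpose₂ (transpose₂ R)⁻¹

/-- `R₂₁`, with `(R₂₁)^i_k^j_l = R^j_l^i_k`. -/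
def flip₂₁ (R : RMat 𝕜 n) : RMat 𝕜 n := fun x y => R x.swap y.swap

/-- `θ_{ij}` is `1` if `i > j` and `0` otherwise. -/
def theta (𝕜 : Type*) [Field 𝕜] (i j : Fin n) : 𝕜 := if j < i then 1 else 0

/-- `μ = q - q⁻¹`. -/
def mu (q : 𝕜) : 𝕜 := q - q⁻¹

/-- `M_{ij} = q δ_{ij} + θ_{ji} q / r_{ij} + θ_{ij} r_{ji} / q`. -/
def coeffM (q : 𝕜) (r : Fin n → Fin n → 𝕜) (i j : Fin n) : 𝕜 :=
  (if i = j then q else 0) + theta 𝕜 j i * (q / r i j) + theta 𝕜 i j * (r j i / q)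

/-- `L_{ij} = θ_{ji} (q - q⁻¹)`. -/
def coeffL (q : 𝕜) (i j : Fin n) : 𝕜 := theta 𝕜 j i * mu q

/-- The multiparameter Hecke R-matrix
`R^i_k^j_l = δ^i_k δ^j_l M_{ij} + δ^i_l δ^j_k L_{ij}`. Only the values `r i j` with `i < j`
are used. -/
def heckeR (q : 𝕜) (r : Fin n → Fin n → 𝕜) : RMat 𝕜 n := fun x y =>
  (if x.1 = y.1 ∧ x.2 = y.2 then coeffM q r x.1 x.2 else 0) +
    (if x.1 = y.2 ∧ x.2 = y.1 then coeffL q x.1 x.2 else 0)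

/-! ### The matrix braided Lie algebra of an R-matrix -/

/-- The `n²`-dimensional vector space with basis `X^i_j`. -/
abbrev L (𝕜 : Type*) [Field 𝕜] (n : ℕ) := Fin n × Fin n → 𝕜

/-- The basis vector `X^i_j`. -/
def X (𝕜 : Type*) [Field 𝕜] {n : ℕ} (i j : Fin n) : L 𝕜 n := Pi.single (i, j) 1

/-- The linear map on `L ⊗ L` with prescribed values on the basis `X^i_j ⊗ X^k_l`. -/
def onBasis {M : Type*} [AddCommGroup M] [Module 𝕜 M]
    (f : Fin n → Fin n → Fin n → Fin n → M) : L 𝕜 n ⊗[𝕜] L 𝕜 n →ₗ[𝕜] M :=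
  ((Pi.basisFun 𝕜 (Fin n × Fin n)).tensorProduct
    (Pi.basisFun 𝕜 (Fin n × Fin n))).constr 𝕜
      fun x => f x.1.1 x.1.2 x.2.1 x.2.2

theorem onBasis_apply {M : Type*} [AddCommGroup M] [Module 𝕜 M]
    (f : Fin n → Fin n → Fin n → Fin n → M) (i j k l : Fin n) :
    onBasis f (X 𝕜 i j ⊗ₜ[𝕜] X 𝕜 k l) = f i j k l := by
  have h := ((Pi.basisFun 𝕜 (Fin n × Fin n)).tensorProduct
    (Pi.basisFun 𝕜 (Fin n × Fin n))).constr_basis 𝕜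
      (fun x => f x.1.1 x.1.2 x.2.1 x.2.2) ((i, j), (k, l))
  rw [Module.Basis.tensorProduct_apply] at h
  simpa [onBasis, X] using h

/-- The element `X^i_j ⊗ X^k_l` of `L ⊗ L`. -/
def XX (𝕜 : Type*) [Field 𝕜] {n : ℕ} (i j k l : Fin n) : L 𝕜 n ⊗[𝕜] L 𝕜 n :=
  X 𝕜 i j ⊗ₜ[𝕜] X 𝕜 k l

/-- The matrix coproduct `Δ X^i_j = ∑ X^i_a ⊗ X^a_j`. -/
def comul (𝕜 : Type*) [Field 𝕜] (n : ℕ) : L 𝕜 n →ₗ[𝕜] L 𝕜 n ⊗[𝕜] L 𝕜 n :=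
  (Pi.basisFun 𝕜 (Fin n × Fin n)).constr 𝕜
    fun x => ∑ a, X 𝕜 x.1 a ⊗ₜ[𝕜] X 𝕜 a x.2

/-- The braiding `Ψ` of the category of right comodules, for the right adjoint coaction
`X^i_j ↦ ∑ X^m_n ⊗ S(t^i_m) t^n_j` and the coquasitriangular structure given by `R`. -/
def Psi (R : RMat 𝕜 n) : L 𝕜 n ⊗[𝕜] L 𝕜 n →ₗ[𝕜] L 𝕜 n ⊗[𝕜] L 𝕜 n :=
  onBasis fun i j k l =>
    ∑ o, ∑ p, ∑ m, ∑ s, ∑ a, ∑ b, ∑ c, ∑ d,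
      (ent R i b a o * ent R⁻¹ b m p d * ent R s c d l * ent (secondInv R) c j k a) •
        (X 𝕜 o p ⊗ₜ[𝕜] X 𝕜 m s)

/-- The braided Lie bracket
`[X^i_j, X^k_l] = ∑ (R⁻¹)^a_m^i_b R^s_c^b_o R^o_d^c_l R̃^d_j^k_a X^m_s`; equivalently
`[R₂₁ X₁ R, X₂] = X₂ R₂₁ R`. -/
def bracket (R : RMat 𝕜 n) : L 𝕜 n ⊗[𝕜] L 𝕜 n →ₗ[𝕜] L 𝕜 n :=
  onBasis fun i j k l =>
    ∑ m, ∑ s, ∑ o, ∑ a, ∑ b, ∑ c, ∑ d,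
      (ent R⁻¹ a m i b * ent R s c b o * ent R o d c l * ent (secondInv R) d j k a) • X 𝕜 m s

/-- The canonical braiding `Υ = ([ , ] ⊗ id) ∘ (id ⊗ Ψ) ∘ (Δ ⊗ id)` of the braided Lie algebra. -/
def Upsilon (R : RMat 𝕜 n) : L 𝕜 n ⊗[𝕜] L 𝕜 n →ₗ[𝕜] L 𝕜 n ⊗[𝕜] L 𝕜 n :=
  (bracket R).rTensor (L 𝕜 n) ∘ₗ
    (TensorProduct.assoc 𝕜 (L 𝕜 n) (L 𝕜 n) (L 𝕜 n)).symm.toLinearMap ∘ₗ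
    (Psi R).lTensor (L 𝕜 n) ∘ₗ
    (TensorProduct.assoc 𝕜 (L 𝕜 n) (L 𝕜 n) (L 𝕜 n)).toLinearMap ∘ₗ
    (comul 𝕜 n).rTensor (L 𝕜 n)

/-! ### The braided enveloping algebra -/

/-- The inclusion of `L ⊗ L` as the degree two part of the tensor algebra `T(L)`. -/
def quad (𝕜 : Type*) [Field 𝕜] (n : ℕ) : L 𝕜 n ⊗[𝕜] L 𝕜 n →ₗ[𝕜] TensorAlgebra 𝕜 (L 𝕜 n) :=
  LinearMap.mul' 𝕜 (TensorAlgebra 𝕜 (L 𝕜 n)) ∘ₗ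
    TensorProduct.map (TensorAlgebra.ι 𝕜) (TensorAlgebra.ι 𝕜)

/-- The relations `(id - Υ)(t) = 0` in the tensor algebra. -/
def EnvRel (R : RMat 𝕜 n) (x y : TensorAlgebra 𝕜 (L 𝕜 n)) : Prop :=
  ∃ t : L 𝕜 n ⊗[𝕜] L 𝕜 n, x = quad 𝕜 n (t - Upsilon R t) ∧ y = 0

/-- The braided enveloping algebra `B(L) = T(L) / ⟨im (id - Υ)⟩`. -/
abbrev Env (R : RMat 𝕜 n) := RingQuot (EnvRel R)

/-- The image of `X^i_j` in `B(L)`. -/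
def envX (R : RMat 𝕜 n) (i j : Fin n) : Env R :=
  RingQuot.mkAlgHom 𝕜 (EnvRel R) (TensorAlgebra.ι 𝕜 (X 𝕜 i j))

/-- The defining relation `R₂₁ Y₁ R Y₂ = Y₂ R₂₁ Y₁ R` of braided matrices, for a matrix `Y` with
entries in an algebra `A`. -/
def Reflection {A : Type*} [Ring A] [Algebra 𝕜 A] (R : RMat 𝕜 n)
    (Y : Matrix (Fin n) (Fin n) A) : Prop :=
  (flip₂₁ R).map (algebraMap 𝕜 A) * (Y ⊗ₖ (1 : Matrix (Fin n) (Fin n) A)) *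
      R.map (algebraMap 𝕜 A) * ((1 : Matrix (Fin n) (Fin n) A) ⊗ₖ Y) =
    ((1 : Matrix (Fin n) (Fin n) A) ⊗ₖ Y) * (flip₂₁ R).map (algebraMap 𝕜 A) *
      (Y ⊗ₖ (1 : Matrix (Fin n) (Fin n) A)) * R.map (algebraMap 𝕜 A)

/-! ### The explicit list of relations -/

/-- `q r_{ca} / (r_{ba} r_{cb})`, used for `a > b > c`. -/
def cocycleVal (q : 𝕜) (r : Fin n → Fin n → 𝕜) (a b c : Fin n) : 𝕜 :=
  q * r c a / (r b a * r c b)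

/-- The cocycle `σ_{ijk}`: for the permutation `σ` of the distinct `i, j, k` with
`σ(i) > σ(j) > σ(k)`, it is `(q r_{σ(k)σ(i)} / (r_{σ(j)σ(i)} r_{σ(k)σ(j)}))^{sign σ}`; it is `0` if
`i, j, k` are not distinct. -/
def cocycle (q : 𝕜) (r : Fin n → Fin n → 𝕜) (i j k : Fin n) : 𝕜 :=
  if k < j ∧ j < i then cocycleVal q r i j k
  else if j < k ∧ k < i then (cocycleVal q r i k j)⁻¹
  else if k < i ∧ i < j then (cocycleVal q r j i k)⁻¹
  else if i < k ∧ k < j then cocycleVal q r j k i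
  else if j < i ∧ i < k then cocycleVal q r k i j
  else if i < j ∧ j < k then (cocycleVal q r k j i)⁻¹
  else 0

/-- `σ̄_{ijk}` is `σ_{ijk}` with `q` and all `r_{ij}` inverted. -/
def cocycleBar (q : 𝕜) (r : Fin n → Fin n → 𝕜) (i j k : Fin n) : 𝕜 :=
  cocycle q⁻¹ (fun a b => (r a b)⁻¹) i j k

/-- The index set of the list of relations; distinct letters stand for distinct indices. -/
inductive RelIndex (n : ℕ) : Type
  | i (i k : Fin n) (h : i < k)
  | iia (i k l : Fin n) (hkl : k ≠ l) (hk : i < k) (hl : i < l)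
  | iib (i k l : Fin n) (hkl : k ≠ l) (hk : k < i) (hl : l < i)
  | iic (i k l : Fin n) (hl : i < l) (hk : k < i)
  | iid (i k l : Fin n) (hk : i < k) (hl : l < i)
  | iie (i l : Fin n) (h : i < l)
  | iif (i l : Fin n) (h : l < i)
  | iig (i k : Fin n) (h : k < i)
  | iih (i k : Fin n) (h : i < k)
  | iiia (i j k l : Fin n) (hij : i ≠ j) (hil : i ≠ l) (hjk : j ≠ k) (hjl : j ≠ l) (hkl : k ≠ l)
      (h : i < k)
  | iiib (i j l : Fin n) (hij : i ≠ j) (hil : i ≠ l) (h : j < l)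
  | iiic (i j k : Fin n) (hij : i ≠ j) (hjk : j ≠ k) (h : i < k)
  | iiid (i j l : Fin n) (hil : i ≠ l) (hjl : j ≠ l) (h : i < j)
  | iiie (i j k : Fin n) (hij : i ≠ j) (hjk : j ≠ k) (h : i < k)
  | iiif (i j : Fin n) (h : i < j)

/-- The relations, each written as (left-hand side) - (right-hand side), where `m i j k l` stands
for the monomial `X^i_j X^k_l`. -/
def relator {M : Type*} [AddCommGroup M] [Module 𝕜 M] (q : 𝕜) (r : Fin n → Fin n → 𝕜)
    (m : Fin n → Fin n → Fin n → Fin n → M) : RelIndex n → M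
  | .i i k _ => m i i k k - m k k i i
  | .iia i k l _ _ _ => m i i k l - m k l i i
  | .iib i k l _ _ _ => m i i k l - m k l i i
  | .iic i k l _ _ => (m i i k l - m k l i i) - (-(mu q * cocycleBar q r k i l) • m i l k i)
  | .iid i k l _ _ => (m i i k l - m k l i i) - (mu q * cocycleBar q r i l k) • m i l k i
  | .iie i l _ => (m i i i l - (q⁻¹) ^ 2 • m i l i i) -
      (-(q⁻¹ * mu q) • ∑ a ∈ Finset.Iio i, m i a a l)
  | .iif i l _ => (m i i i l - m i l i i) - (-(q⁻¹ * mu q) • ∑ a ∈ Finset.Iio i, m i a a l)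
  | .iig i k _ => (m i i k i - m k i i i) - (mu q * q⁻¹) • ∑ a ∈ Finset.Iio i, m k a a i
  | .iih i k _ => (m i i k i - q ^ 2 • m k i i i) - (mu q * q) • ∑ a ∈ Finset.Iio i, m k a a i
  | .iiia i j k l _ _ _ _ _ _ =>
      (m i j k l - (cocycle q r i j k * cocycleBar q r i j l) • m k l i j) -
        (mu q * theta 𝕜 j l * cocycle q r i j k) • m k j i l
  | .iiib i j l _ _ _ => q • m i j i l - cocycleBar q r i j l • m i l i j
  | .iiic i j k _ _ _ => m i j k j - (q * cocycle q r i j k) • m k j i j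
  | .iiid i j l _ _ _ => (q • m i j j l - cocycleBar q r j l i • m j l i j) -
      (-mu q • ∑ a ∈ Finset.Iio j, m i a a l + (mu q * theta 𝕜 j l) • m j j i l)
  | .iiie i j k _ _ _ => (cocycleBar q r i j k • m i j k i - q • m k i i j) -
      (mu q • ∑ a ∈ Finset.Iio i, m k a a j + (mu q * theta 𝕜 j i) • m k j i i)
  | .iiif i j _ => (m i j j i - m j i i j) -
      ((q * mu q) • ∑ a ∈ Finset.Iio i, q ^ (2 * ((a : ℤ) - (i : ℤ))) • m a j j a
        + (q⁻¹ * mu q) • m j j i i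
        - (q⁻¹ * mu q) • ∑ a ∈ Finset.Iio j, m i a a i
        + mu q ^ 2 • ∑ b ∈ Finset.Iio j, ∑ a ∈ Finset.Iio i,
            q ^ (2 * ((a : ℤ) - (i : ℤ))) • m a b b a
        - mu q ^ 2 • ∑ a ∈ Finset.Iio i, q ^ (2 * ((a : ℤ) - (i : ℤ))) • m j j a a)

end BraidedMatrix

end

open BraidedMatrix

/-! A linear map `φ` on `L ⊗ L` kills `im (id - Υ)` exactly when the values `φ (X^i_j ⊗ X^k_l)`
satisfy the reflection equation `R₂₁ X₁ R X₂ = X₂ R₂₁ X₁ R`. Indeed, multiplying that equation by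
`R⁻¹` and then by `R̃` solves it for the monomial on its left side (`breflects_iff`), and the
resulting right side is the closed formula for `Υ` (`Upsilon_XX`). Everything is therefore reduced
to families `m i j k l` in an arbitrary module that satisfy the reflection equation. Quotients of `L
⊗ L` as target give the span of the relations; algebras as target give `B(L)` and the braided
matrices.

For the Hecke R-matrix each entry of the equation (`reflector`) is short: a permutation-like part
with coefficients `M`, `L`, and a sum over smaller indices when two inner indices agree. The cocycle
is a product of three coefficients `M`, so every listed relation except `iiif` is a nonzero multiple
of one entry; `iiif` is one modulo earlier entries, after a triangular recursion is solved. The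
entries not listed follow from the listed ones by linear symmetries (`reflector_row`,
`reflector_col`, `reflector_swap`), which gives `breflects_iff_relator`.

The relations are counted by the unordered pair of generators that each one reorders, and are
independent because suitable leading monomials make the coefficient matrix triangular. -/

noncomputable section

namespace BraidedMatrix

variable {𝕜 : Type*} [Field 𝕜] {n : ℕ}

/-! ### The reflection relation for module-valued monomials -/

section General

variable {M : Type*} [AddCommGroup M] [Module 𝕜 M]

/-- The relation `R₂₁ X₁ R X₂ = X₂ R₂₁ X₁ R`, where `m i j k l` stands for the monomial
`X^i_j X^k_l`. -/
def BReflects (R : RMat 𝕜 n) (m : Fin n → Fin n → Fin n → Fin n → M) : Prop :=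
  ∀ u v x l, ∑ y, ∑ i, ent R u y v i • ∑ j, ∑ k, ent R j x y k • m i j k l =
    ∑ p, ∑ c, ent R p x c l • ∑ s, ∑ o, ent R s c v o • m u s o p

/-- The contracted pair is the row index of `P` and the column index of `Q`, so the product that
appears is `Q * P`, not `P * Q`. -/
theorem sum_contract {P Q : RMat 𝕜 n} (h : Q * P = 1) (f : Fin n → Fin n → M) (b e : Fin n) :
    ∑ a, ∑ o, P (a, o) (b, e) • ∑ c, ∑ d, Q (c, d) (a, o) • f c d = f b e := by
  have h1 : ∀ z, ∑ x, P x (b, e) * Q z x = (1 : RMat 𝕜 n) z (b, e) := fun z => by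
    rw [← h, Matrix.mul_apply]
    exact Finset.sum_congr rfl fun x _ => mul_comm _ _
  calc _ = ∑ x, P x (b, e) • ∑ z, Q z x • f z.1 z.2 := by simp only [Fintype.sum_prod_type]
    _ = ∑ z, (∑ x, P x (b, e) * Q z x) • f z.1 z.2 := by
      simp only [Finset.smul_sum, smul_smul, Finset.sum_smul]
      exact Finset.sum_comm
    _ = f b e := by
      simp only [h1, Matrix.one_apply, ite_smul, zero_smul, one_smul]
      simp

theorem sum_solve {P Q : RMat 𝕜 n} (h : P * Q = 1) (h' : Q * P = 1) (f g : Fin n → Fin n → M) :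
    (∀ a b, ∑ c, ∑ d, P (a, b) (c, d) • f c d = g a b) ↔
      ∀ c d, f c d = ∑ a, ∑ b, Q (c, d) (a, b) • g a b := by
  have key {P Q : RMat 𝕜 n} (h : P * Q = 1) (g : Fin n → Fin n → M) (a b : Fin n) :
      ∑ c, ∑ d, P (a, b) (c, d) • ∑ e, ∑ k, Q (c, d) (e, k) • g e k = g a b := by
    -- Here the contraction runs over columns of `P`; transposing brings it to the form of
    -- `sum_contract`.
    have h2 : Q.transpose * P.transpose = 1 := by
      rw [← Matrix.transpose_mul, h, Matrix.transpose_one]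
    exact sum_contract h2 g a b
  constructor
  · intro H c d
    simp only [← H]
    exact (key h' f c d).symm
  · intro H a b
    simp only [H]
    exact key h g a b

theorem ent_secondInv (R : RMat 𝕜 n) (c j k a : Fin n) :
    ent (secondInv R) c j k a = (transpose₂ R)⁻¹ (c, a) (j, k) := rfl

omit [Field 𝕜] in
theorem ent_eq_transpose₂ (R : RMat 𝕜 n) (a b c d : Fin n) :
    ent R a b c d = transpose₂ R (a, d) (b, c) := rfl

variable {R : RMat 𝕜 n}

/-- The outer `R` on the left side is removed by `R⁻¹`. The inner one is contracted along one upper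
and one lower index, so it acts as the transpose of `R^{t₂}` and is removed by `R̃`. Both steps are
reversible. -/
theorem breflects_iff (hR : IsUnit R.det) (hR' : IsUnit (transpose₂ R).det)
    (m : Fin n → Fin n → Fin n → Fin n → M) :
    BReflects R m ↔ ∀ i j k l, m i j k l = ∑ x, ∑ y, ent (secondInv R) x j k y •
      ∑ u, ∑ v, ent R⁻¹ y u i v • ∑ p, ∑ c, ent R p x c l • ∑ s, ∑ o, ent R s c v o • m u s o p := by
  have h1 := fun x l => sum_solve (Matrix.mul_nonsing_inv R hR) (Matrix.nonsing_inv_mul R hR)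
    (fun y i => ∑ j, ∑ k, ent R j x y k • m i j k l)
    (fun u v => ∑ p, ∑ c, ent R p x c l • ∑ s, ∑ o, ent R s c v o • m u s o p)
  have h2 := fun i l => sum_solve (P := (transpose₂ R).transpose)
    (Q := (transpose₂ R)⁻¹.transpose)
    (by rw [← Matrix.transpose_mul, Matrix.nonsing_inv_mul _ hR', Matrix.transpose_one])
    (by rw [← Matrix.transpose_mul, Matrix.mul_nonsing_inv _ hR', Matrix.transpose_one])
    (fun j k => m i j k l)
    (fun x y => ∑ u, ∑ v, ent R⁻¹ y u i v •
      ∑ p, ∑ c, ent R p x c l • ∑ s, ∑ o, ent R s c v o • m u s o p)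
  constructor
  · intro H i j k l
    exact (h2 i l).1 (fun x y => (h1 x l).1 (fun u v => H u v x l) y i) j k
  · intro H u v x l
    exact (h1 x l).2 (fun y i => (h2 i l).2 (fun j k => H i j k l) x y) u v

end General

/-! ### The canonical braiding -/

theorem Upsilon_XX_aux (R : RMat 𝕜 n) (i j k l : Fin n) :
    Upsilon R (XX 𝕜 i j k l) = ∑ a, ∑ o, ∑ p, ∑ m, ∑ s,
      (∑ a', ∑ b, ∑ c, ∑ d, ent R a b a' o * ent R⁻¹ b m p d * ent R s c d l *
        ent (secondInv R) c j k a') • (bracket R (X 𝕜 i a ⊗ₜ X 𝕜 o p) ⊗ₜ[𝕜] X 𝕜 m s) := by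
  have h : comul 𝕜 n (X 𝕜 i j) = ∑ a, X 𝕜 i a ⊗ₜ[𝕜] X 𝕜 a j := by
    simp [comul, X]
  simp only [Upsilon, XX, LinearMap.comp_apply, LinearMap.rTensor_tmul, h,
    TensorProduct.sum_tmul, map_sum, LinearEquiv.coe_coe, TensorProduct.assoc_tmul,
    LinearMap.lTensor_tmul, Psi, onBasis_apply, TensorProduct.tmul_sum, TensorProduct.tmul_smul,
    map_smul, TensorProduct.assoc_symm_tmul, Finset.sum_smul]

section Upsilon

variable {R : RMat 𝕜 n}

/-- The first `R` of `Ψ` meets the `R̃` of the bracket through the indices `a`, `o`, which contract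
`R^{t₂}` with its inverse to the identity. -/
theorem bracket_contract (hR' : IsUnit (transpose₂ R).det) (i p b a' : Fin n) :
    ∑ a, ∑ o, ent R a b a' o • bracket R (X 𝕜 i a ⊗ₜ X 𝕜 o p) =
      ∑ o, ∑ c, ent R o b c p • ∑ m, ∑ s, ∑ b', (ent R⁻¹ a' m i b' * ent R s c b' o) • X 𝕜 m s := by
  rw [← sum_contract (Matrix.nonsing_inv_mul _ hR') (fun b a' => ∑ o, ∑ c, ent R o b c p •
    ∑ m, ∑ s, ∑ b', (ent R⁻¹ a' m i b' * ent R s c b' o) • X 𝕜 m s) b a']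
  refine Finset.sum_congr rfl fun a _ => Finset.sum_congr rfl fun o _ => ?_
  rw [ent_eq_transpose₂, bracket, onBasis_apply]
  congr 1
  simp only [← ent_secondInv, Finset.smul_sum, smul_smul]
  -- The nested sums are flattened to one sum over a product, so that a single bijection reorders
  -- all indices at once.
  calc _ = ∑ t : Fin n × Fin n × Fin n × Fin n × Fin n × Fin n × Fin n,
      (ent R⁻¹ t.2.2.2.1 t.1 i t.2.2.2.2.1 * ent R t.2.1 t.2.2.2.2.2.1 t.2.2.2.2.1 t.2.2.1 *
        ent R t.2.2.1 t.2.2.2.2.2.2 t.2.2.2.2.2.1 p *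
        ent (secondInv R) t.2.2.2.2.2.2 a o t.2.2.2.1) • X 𝕜 t.1 t.2.1 := by
        simp only [Fintype.sum_prod_type]
    _ = ∑ t : Fin n × Fin n × Fin n × Fin n × Fin n × Fin n × Fin n,
      (ent (secondInv R) t.1 a o t.2.1 * (ent R t.2.2.1 t.1 t.2.2.2.1 p *
        (ent R⁻¹ t.2.1 t.2.2.2.2.1 i t.2.2.2.2.2.2 *
          ent R t.2.2.2.2.2.1 t.2.2.2.1 t.2.2.2.2.2.2 t.2.2.1))) •
        X 𝕜 t.2.2.2.2.1 t.2.2.2.2.2.1 := by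
        refine Fintype.sum_equiv
          ⟨fun ⟨m, s, o, a, b, c, d⟩ => (d, a, o, c, m, s, b),
            fun ⟨d, a, o, c, m, s, b⟩ => (m, s, o, a, b, c, d), fun _ => rfl, fun _ => rfl⟩ _ _ ?_
        rintro ⟨m, s, o, a, b, c, d⟩
        dsimp only [Equiv.coe_fn_mk]
        congr 1
        ring
    _ = _ := by simp only [Fintype.sum_prod_type]

/-- Of the four factors in `Ψ` and the four in the bracket, two pairs cancel: `R` against `R̃` by
`bracket_contract`, then the `R⁻¹` of `Ψ` against an `R` of the bracket. Four factors remain. -/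
theorem Upsilon_XX (hR : IsUnit R.det) (hR' : IsUnit (transpose₂ R).det) (i j k l : Fin n) :
    Upsilon R (XX 𝕜 i j k l) =
        ∑ m, ∑ s, ∑ o, ∑ p, ∑ a, ∑ b, ∑ c, ∑ d,
          (ent R⁻¹ a m i b * ent R s c b o * ent R p d c l * ent (secondInv R) d j k a) •
          XX 𝕜 m s o p := by
  rw [Upsilon_XX_aux]
  have step : ∀ m a' d, ∑ b, ∑ p, ent R⁻¹ b m p d •
      (∑ a, ∑ o, ent R a b a' o • bracket R (X 𝕜 i a ⊗ₜ X 𝕜 o p)) =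
      ∑ m', ∑ s, ∑ b', (ent R⁻¹ a' m' i b' * ent R s d b' m) • X 𝕜 m' s := by
    intro m a' d
    simp only [bracket_contract hR']
    exact sum_contract (Matrix.mul_nonsing_inv R hR) (fun o c => ∑ m', ∑ s, ∑ b',
      (ent R⁻¹ a' m' i b' * ent R s c b' o) • X 𝕜 m' s) m d
  trans ∑ m, ∑ s, ∑ a', ∑ c, ∑ d, (ent R s c d l * ent (secondInv R) c j k a') •
    ((∑ b, ∑ p, ent R⁻¹ b m p d •
      (∑ a, ∑ o, ent R a b a' o • bracket R (X 𝕜 i a ⊗ₜ X 𝕜 o p))) ⊗ₜ[𝕜] X 𝕜 m s)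
  · simp only [Finset.smul_sum, Finset.sum_smul, smul_smul, TensorProduct.sum_tmul,
      ← TensorProduct.smul_tmul']
    calc _ = ∑ t : Fin n × Fin n × Fin n × Fin n × Fin n × Fin n × Fin n × Fin n × Fin n,
        (ent R t.1 t.2.2.2.2.2.2.1 t.2.2.2.2.2.1 t.2.1 *
          ent R⁻¹ t.2.2.2.2.2.2.1 t.2.2.2.1 t.2.2.1 t.2.2.2.2.2.2.2.2 *
          ent R t.2.2.2.2.1 t.2.2.2.2.2.2.2.1 t.2.2.2.2.2.2.2.2 l *
          ent (secondInv R) t.2.2.2.2.2.2.2.1 j k t.2.2.2.2.2.1) •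
          (bracket R (X 𝕜 i t.1 ⊗ₜ X 𝕜 t.2.1 t.2.2.1) ⊗ₜ[𝕜] X 𝕜 t.2.2.2.1 t.2.2.2.2.1) := by
          simp only [Fintype.sum_prod_type]
      _ = ∑ t : Fin n × Fin n × Fin n × Fin n × Fin n × Fin n × Fin n × Fin n × Fin n,
        (ent R t.2.1 t.2.2.2.1 t.2.2.2.2.1 l * ent (secondInv R) t.2.2.2.1 j k t.2.2.1 *
          (ent R⁻¹ t.2.2.2.2.2.1 t.1 t.2.2.2.2.2.2.1 t.2.2.2.2.1 *
          ent R t.2.2.2.2.2.2.2.1 t.2.2.2.2.2.1 t.2.2.1 t.2.2.2.2.2.2.2.2)) •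
          (bracket R (X 𝕜 i t.2.2.2.2.2.2.2.1 ⊗ₜ X 𝕜 t.2.2.2.2.2.2.2.2 t.2.2.2.2.2.2.1) ⊗ₜ[𝕜]
            X 𝕜 t.1 t.2.1) := by
          refine Fintype.sum_equiv
            ⟨fun ⟨a, o, p, m, s, a', b, c, d⟩ => (m, s, a', c, d, b, p, a, o),
              fun ⟨m, s, a', c, d, b, p, a, o⟩ => (a, o, p, m, s, a', b, c, d),
              fun _ => rfl, fun _ => rfl⟩ _ _ ?_
          rintro ⟨a, o, p, m, s, a', b, c, d⟩
          dsimp only [Equiv.coe_fn_mk]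
          congr 1
          ring
      _ = _ := by simp only [Fintype.sum_prod_type]
  · simp only [step]
    simp only [Finset.smul_sum, smul_smul, TensorProduct.sum_tmul, ← TensorProduct.smul_tmul']
    calc _ = ∑ t : Fin n × Fin n × Fin n × Fin n × Fin n × Fin n × Fin n × Fin n,
        (ent R t.2.1 t.2.2.2.1 t.2.2.2.2.1 l * ent (secondInv R) t.2.2.2.1 j k t.2.2.1 *
          (ent R⁻¹ t.2.2.1 t.2.2.2.2.2.1 i t.2.2.2.2.2.2.2 *
            ent R t.2.2.2.2.2.2.1 t.2.2.2.2.1 t.2.2.2.2.2.2.2 t.1)) •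
          (X 𝕜 t.2.2.2.2.2.1 t.2.2.2.2.2.2.1 ⊗ₜ[𝕜] X 𝕜 t.1 t.2.1) := by
          simp only [Fintype.sum_prod_type]
      _ = ∑ t : Fin n × Fin n × Fin n × Fin n × Fin n × Fin n × Fin n × Fin n,
        (ent R⁻¹ t.2.2.2.2.1 t.1 i t.2.2.2.2.2.1 *
          ent R t.2.1 t.2.2.2.2.2.2.1 t.2.2.2.2.2.1 t.2.2.1 *
          ent R t.2.2.2.1 t.2.2.2.2.2.2.2 t.2.2.2.2.2.2.1 l *
          ent (secondInv R) t.2.2.2.2.2.2.2 j k t.2.2.2.2.1) •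
          XX 𝕜 t.1 t.2.1 t.2.2.1 t.2.2.2.1 := by
          refine Fintype.sum_equiv
            ⟨fun ⟨m, s, a', c, d, m', s', b'⟩ => (m', s', m, s, a', b', d, c),
              fun ⟨m', s', m, s, a', b', d, c⟩ => (m, s, a', c, d, m', s', b'),
              fun _ => rfl, fun _ => rfl⟩ _ _ ?_
          rintro ⟨m, s, a', c, d, m', s', b'⟩
          dsimp only [Equiv.coe_fn_mk, XX]
          congr 1
          ring
      _ = _ := by simp only [Fintype.sum_prod_type]

variable {M : Type*} [AddCommGroup M] [Module 𝕜 M]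

theorem linearMap_ext_XX {φ ψ : L 𝕜 n ⊗[𝕜] L 𝕜 n →ₗ[𝕜] M}
    (h : ∀ i j k l, φ (XX 𝕜 i j k l) = ψ (XX 𝕜 i j k l)) : φ = ψ := by
  refine ((Pi.basisFun 𝕜 (Fin n × Fin n)).tensorProduct (Pi.basisFun 𝕜 (Fin n × Fin n))).ext ?_
  rintro ⟨⟨i, j⟩, k, l⟩
  simpa [Module.Basis.tensorProduct_apply, XX, X] using h i j k l

/-- A linear map vanishes on the image of `id - Υ` exactly when its values on the monomials satisfy
the reflection relation. -/
theorem comp_id_sub_Upsilon_eq_zero_iff (hR : IsUnit R.det) (hR' : IsUnit (transpose₂ R).det)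
    (φ : L 𝕜 n ⊗[𝕜] L 𝕜 n →ₗ[𝕜] M) :
    φ ∘ₗ (LinearMap.id - Upsilon R) = 0 ↔ BReflects R fun i j k l => φ (XX 𝕜 i j k l) := by
  have h1 : φ ∘ₗ (LinearMap.id - Upsilon R) = 0 ↔
      ∀ i j k l, φ (XX 𝕜 i j k l) = φ (Upsilon R (XX 𝕜 i j k l)) := by
    constructor
    · intro h i j k l
      have := LinearMap.congr_fun h (XX 𝕜 i j k l)
      simpa [sub_eq_zero] using this
    · intro h
      refine linearMap_ext_XX fun i j k l => ?_
      simp [← h i j k l]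
  rw [h1, breflects_iff hR hR']
  refine forall_congr' fun i => forall_congr' fun j => forall_congr' fun k => forall_congr' fun l =>
    Eq.congr rfl ?_
  rw [Upsilon_XX hR hR']
  simp only [map_sum, map_smul, Finset.smul_sum, smul_smul]
  calc _ = ∑ t : Fin n × Fin n × Fin n × Fin n × Fin n × Fin n × Fin n × Fin n,
        (ent R⁻¹ t.2.2.2.2.1 t.1 i t.2.2.2.2.2.1 *
          ent R t.2.1 t.2.2.2.2.2.2.1 t.2.2.2.2.2.1 t.2.2.1 *
          ent R t.2.2.2.1 t.2.2.2.2.2.2.2 t.2.2.2.2.2.2.1 l *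
          ent (secondInv R) t.2.2.2.2.2.2.2 j k t.2.2.2.2.1) •
          φ (XX 𝕜 t.1 t.2.1 t.2.2.1 t.2.2.2.1) := by simp only [Fintype.sum_prod_type]
    _ = ∑ t : Fin n × Fin n × Fin n × Fin n × Fin n × Fin n × Fin n × Fin n,
        (ent (secondInv R) t.1 j k t.2.1 * (ent R⁻¹ t.2.1 t.2.2.1 i t.2.2.2.1 *
          (ent R t.2.2.2.2.1 t.1 t.2.2.2.2.2.1 l *
            ent R t.2.2.2.2.2.2.1 t.2.2.2.2.2.1 t.2.2.2.1 t.2.2.2.2.2.2.2))) •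
          φ (XX 𝕜 t.2.2.1 t.2.2.2.2.2.2.1 t.2.2.2.2.2.2.2 t.2.2.2.2.1) := by
        refine Fintype.sum_equiv
          ⟨fun ⟨m, s, o, p, a, b, c, d⟩ => (d, a, m, b, p, c, s, o),
            fun ⟨d, a, m, b, p, c, s, o⟩ => (m, s, o, p, a, b, c, d),
            fun _ => rfl, fun _ => rfl⟩ _ _ ?_
        rintro ⟨m, s, o, p, a, b, c, d⟩
        dsimp only [Equiv.coe_fn_mk]
        congr 1
        ring
    _ = _ := by simp only [Fintype.sum_prod_type]

/-- The entries of `R` are central in `A`, so they can be moved out of the matrix products. The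
equation labelled `u v x l` is the matrix entry in row `(v, u)`, because `R₂₁` reads its pairs in
reverse order. -/
theorem reflection_iff {A : Type*} [Ring A] [Algebra 𝕜 A] (R : RMat 𝕜 n) (Y : Fin n → Fin n → A) :
    Reflection R (Matrix.of Y) ↔ BReflects R fun i j k l => Y i j * Y k l := by
  have h1 (u v x l : Fin n) : ((flip₂₁ R).map (algebraMap 𝕜 A) *
      (Matrix.of Y ⊗ₖ (1 : Matrix (Fin n) (Fin n) A)) * R.map (algebraMap 𝕜 A) *
        ((1 : Matrix (Fin n) (Fin n) A) ⊗ₖ Matrix.of Y)) (v, u) (x, l) =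
      ∑ y, ∑ i, ent R u y v i • ∑ j, ∑ k, ent R j x y k • (Y i j * Y k l) := by
    have e1 (j y : Fin n) : ((flip₂₁ R).map (algebraMap 𝕜 A) *
        (Matrix.of Y ⊗ₖ (1 : Matrix (Fin n) (Fin n) A))) (v, u) (j, y) =
        ∑ i, ent R u y v i • Y i j := by
      simp [Matrix.mul_apply, Fintype.sum_prod_type, Matrix.one_apply, Algebra.smul_def, flip₂₁,
        ent]
    have e2 (k : Fin n) : ((flip₂₁ R).map (algebraMap 𝕜 A) *
        (Matrix.of Y ⊗ₖ (1 : Matrix (Fin n) (Fin n) A)) * R.map (algebraMap 𝕜 A)) (v, u) (x, k) =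
        ∑ j, ∑ y, ∑ i, (ent R j x y k * ent R u y v i) • Y i j := by
      rw [Matrix.mul_apply, Fintype.sum_prod_type]
      simp only [e1, Matrix.map_apply, ← Algebra.commutes, ← Algebra.smul_def, Finset.smul_sum,
        smul_smul]
      rfl
    rw [Matrix.mul_apply, Fintype.sum_prod_type]
    simp only [Matrix.kroneckerMap_apply, Matrix.one_apply, ite_mul, one_mul, zero_mul, mul_ite,
      mul_zero, Matrix.of_apply]
    rw [Finset.sum_comm]
    simp only [Finset.sum_ite_eq', Finset.mem_univ, if_true, e2, Finset.sum_mul, Finset.smul_sum,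
      smul_smul, smul_mul_assoc]
    calc _ = ∑ t : Fin n × Fin n × Fin n × Fin n,
          (ent R t.2.1 x t.2.2.1 t.1 * ent R u t.2.2.1 v t.2.2.2) • (Y t.2.2.2 t.2.1 * Y t.1 l) := by
          simp only [Fintype.sum_prod_type]
      _ = ∑ t : Fin n × Fin n × Fin n × Fin n,
          (ent R u t.1 v t.2.1 * ent R t.2.2.1 x t.1 t.2.2.2) •
            (Y t.2.1 t.2.2.1 * Y t.2.2.2 l) := by
          refine Fintype.sum_equiv ⟨fun ⟨k, j, y, i⟩ => (y, i, j, k),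
            fun ⟨y, i, j, k⟩ => (k, j, y, i), fun _ => rfl, fun _ => rfl⟩ _ _ ?_
          rintro ⟨k, j, y, i⟩
          dsimp only [Equiv.coe_fn_mk]
          rw [mul_comm]
      _ = _ := by simp only [Fintype.sum_prod_type]
  have h2 (u v x l : Fin n) : (((1 : Matrix (Fin n) (Fin n) A) ⊗ₖ Matrix.of Y) *
      (flip₂₁ R).map (algebraMap 𝕜 A) *
      (Matrix.of Y ⊗ₖ (1 : Matrix (Fin n) (Fin n) A)) * R.map (algebraMap 𝕜 A)) (v, u) (x, l) =
      ∑ p, ∑ c, ent R p x c l • ∑ s, ∑ o, ent R s c v o • (Y u s * Y o p) := by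
    have e1 (o c : Fin n) : (((1 : Matrix (Fin n) (Fin n) A) ⊗ₖ Matrix.of Y) *
        (flip₂₁ R).map (algebraMap 𝕜 A)) (v, u) (o, c) = ∑ s, ent R s c v o • Y u s := by
      simp [Matrix.mul_apply, Fintype.sum_prod_type_right, Matrix.one_apply, Algebra.smul_def,
        flip₂₁, ent, Algebra.commutes]
    have e2 (p c : Fin n) : (((1 : Matrix (Fin n) (Fin n) A) ⊗ₖ Matrix.of Y) *
        (flip₂₁ R).map (algebraMap 𝕜 A) * (Matrix.of Y ⊗ₖ (1 : Matrix (Fin n) (Fin n) A)))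
        (v, u) (p, c) = ∑ s, ∑ o, ent R s c v o • (Y u s * Y o p) := by
      rw [Matrix.mul_apply, Fintype.sum_prod_type, Finset.sum_comm]
      simp [e1, Matrix.one_apply, Finset.sum_mul]
      exact Finset.sum_comm
    rw [Matrix.mul_apply, Fintype.sum_prod_type]
    simp only [e2, Matrix.map_apply, ← Algebra.commutes, ← Algebra.smul_def]
    rfl
  constructor
  · intro h u v x l
    rw [← h1, ← h2, h]
  · intro h
    ext ⟨v, u⟩ ⟨x, l⟩
    rw [h1, h2, h]

end Upsilon

/-! ### Invertibility of the Hecke R-matrix, and the cocycle as a product of its coefficients -/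

section HeckeR

theorem coeffM_self (q : 𝕜) (r : Fin n → Fin n → 𝕜) (i : Fin n) : coeffM q r i i = q := by
  simp [coeffM, theta]

theorem coeffM_of_lt (q : 𝕜) (r : Fin n → Fin n → 𝕜) {i j : Fin n} (h : i < j) :
    coeffM q r i j = q / r i j := by
  simp [coeffM, theta, h, h.ne, h.not_gt]

theorem coeffM_of_gt (q : 𝕜) (r : Fin n → Fin n → 𝕜) {i j : Fin n} (h : j < i) :
    coeffM q r i j = r j i / q := by
  simp [coeffM, theta, h, h.ne', h.not_gt]

variable {q : 𝕜} {r : Fin n → Fin n → 𝕜}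

theorem coeffM_ne_zero (hq : q ≠ 0) (hr : ∀ i j, i < j → r i j ≠ 0) (i j : Fin n) :
    coeffM q r i j ≠ 0 := by
  rcases lt_trichotomy i j with h | rfl | h
  · rw [coeffM_of_lt q r h]; exact div_ne_zero hq (hr _ _ h)
  · rwa [coeffM_self]
  · rw [coeffM_of_gt q r h]; exact div_ne_zero (hr _ _ h) hq

theorem coeffM_swap {i j : Fin n} (h : i ≠ j) : coeffM q r j i = (coeffM q r i j)⁻¹ := by
  rcases h.lt_or_gt with h | h
  · rw [coeffM_of_lt q r h, coeffM_of_gt q r h, inv_div]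
  · rw [coeffM_of_lt q r h, coeffM_of_gt q r h, inv_div]

theorem ent_heckeR (q : 𝕜) (r : Fin n → Fin n → 𝕜) (i k j l : Fin n) :
    ent (heckeR q r) i k j l = (if i = k ∧ j = l then coeffM q r i j else 0) +
      (if i = l ∧ j = k then coeffL q i j else 0) := rfl

theorem coeffL_eq_zero (q : 𝕜) {i j : Fin n} (h : j ≤ i) : coeffL q i j = 0 := by
  simp [coeffL, theta, h.not_gt]

/-- A matrix on pairs which is upper triangular for the lexicographic order and has nonzero
diagonal entries is invertible. -/
theorem isUnit_det_of_lex_triangular (T : RMat 𝕜 n) (hd : ∀ x, T x x ≠ 0)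
    (ht : ∀ x y, toLex y < toLex x → T x y = 0) : IsUnit T.det := by
  have h : (T.submatrix ofLex ofLex).BlockTriangular id := fun x y hxy => ht _ _ hxy
  have h3 := Matrix.det_submatrix_equiv_self ofLex T
  rw [Matrix.det_of_isUpperTriangular h] at h3
  rw [← h3, isUnit_iff_ne_zero]
  exact Finset.prod_ne_zero_iff.2 fun x _ => hd _

/-- Off the diagonal only the entries at `(i, j), (j, i)` with `i < j` can be nonzero, and they lie
above the lexicographic diagonal. -/
theorem isUnit_det_heckeR (hq : q ≠ 0) (hr : ∀ i j, i < j → r i j ≠ 0) :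
    IsUnit (heckeR q r).det := by
  refine isUnit_det_of_lex_triangular _ (fun x => ?_) fun x y hxy => ?_
  · have h : heckeR q r x x = coeffM q r x.1 x.2 := by
      by_cases h : x.1 = x.2
      · simp [heckeR, h, coeffL_eq_zero]
      · simp [heckeR, h]
    rw [h]; exact coeffM_ne_zero hq hr _ _
  · obtain ⟨i, j⟩ := x
    obtain ⟨k, l⟩ := y
    rw [Prod.Lex.toLex_lt_toLex] at hxy
    simp only [heckeR] at hxy ⊢
    rw [if_neg (by rintro ⟨rfl, rfl⟩; simp at hxy), zero_add]
    split_ifs with h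
    · obtain ⟨rfl, rfl⟩ := h
      exact coeffL_eq_zero q (by rcases hxy with h | h; exacts [h.le, h.1.le])
    · rfl

/-- After the partial transposition the `L` part sits at `(i, i), (k, k)` with `i < k`, again above
the diagonal. -/
theorem isUnit_det_transpose₂_heckeR (hq : q ≠ 0) (hr : ∀ i j, i < j → r i j ≠ 0) :
    IsUnit (transpose₂ (heckeR q r)).det := by
  refine isUnit_det_of_lex_triangular _ (fun x => ?_) fun x y hxy => ?_
  · have h : transpose₂ (heckeR q r) x x = coeffM q r x.1 x.2 := by
      by_cases h : x.1 = x.2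
      · simp [heckeR, h, coeffL_eq_zero, transpose₂]
      · simp [heckeR, h, transpose₂]
    rw [h]; exact coeffM_ne_zero hq hr _ _
  · obtain ⟨i, j⟩ := x
    obtain ⟨k, l⟩ := y
    rw [Prod.Lex.toLex_lt_toLex] at hxy
    simp only [heckeR, transpose₂] at hxy ⊢
    rw [if_neg (by rintro ⟨rfl, rfl⟩; simp at hxy), zero_add]
    split_ifs with h
    · obtain ⟨rfl, rfl⟩ := h
      exact coeffL_eq_zero q (by rcases hxy with h | h; exacts [h.le, h.1.le])
    · rfl

/-- One formula replaces the six cases: reversing an index pair inverts `M`, which accounts for the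
exponent `sign σ`. -/
theorem cocycle_eq (hq : q ≠ 0) (hr : ∀ i j, i < j → r i j ≠ 0) {i j k : Fin n}
    (hij : i ≠ j) (hjk : j ≠ k) (hik : i ≠ k) :
    cocycle q r i j k = coeffM q r i k * coeffM q r k j * coeffM q r j i := by
  rcases hij.lt_or_gt with h1 | h1 <;> rcases hjk.lt_or_gt with h2 | h2 <;>
    rcases hik.lt_or_gt with h3 | h3 <;>
    first
    | (exfalso; omega)
    | (have e1 := hr _ _ h1
       have e2 := hr _ _ h2
       have e3 := hr _ _ h3
       simp only [cocycle, cocycleVal, h1, h2, h3, h1.not_gt, h2.not_gt, h3.not_gt,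
         and_true, and_false, if_true, if_false, coeffM_of_lt, coeffM_of_gt]
       field_simp)

theorem cocycleBar_eq_inv (q : 𝕜) (r : Fin n → Fin n → 𝕜) (i j k : Fin n) :
    cocycleBar q r i j k = (cocycle q r i j k)⁻¹ := by
  have h (a b c : Fin n) : cocycleVal q⁻¹ (fun a b => (r a b)⁻¹) a b c = (cocycleVal q r a b c)⁻¹ := by
    simp only [cocycleVal, mul_inv, div_eq_mul_inv]
  simp only [cocycleBar, cocycle, h]
  -- When the indices are not distinct both sides are `0`, by the convention `0⁻¹ = 0`.
  split_ifs <;> simp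

theorem cocycleBar_eq (hq : q ≠ 0) (hr : ∀ i j, i < j → r i j ≠ 0) {i j k : Fin n}
    (hij : i ≠ j) (hjk : j ≠ k) (hik : i ≠ k) :
    cocycleBar q r i j k = coeffM q r i j * coeffM q r j k * coeffM q r k i := by
  rw [cocycleBar_eq_inv, cocycle_eq hq hr hij hjk hik, coeffM_swap hik, coeffM_swap hij,
    coeffM_swap hjk]
  simp only [mul_inv, inv_inv]
  ring

end HeckeR

/-! ### The reflection relation of the Hecke R-matrix in explicit form -/

section Explicit

variable {M : Type*} [AddCommGroup M] [Module 𝕜 M] (q : 𝕜) (r : Fin n → Fin n → 𝕜)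

theorem sum_heckeR_swap (f : Fin n → Fin n → M) (u v : Fin n) :
    ∑ y, ∑ i, ent (heckeR q r) u y v i • f y i =
      coeffM q r u v • f u v + coeffL q u v • f v u := by
  simp only [ent_heckeR, add_smul, ite_smul, zero_smul, Finset.sum_add_distrib, ite_and,
    Finset.sum_ite_eq, Finset.sum_ite_irrel, Finset.sum_const_zero, Finset.mem_univ, if_true]

theorem sum_heckeR_swap' (f : Fin n → Fin n → M) (x l : Fin n) :
    ∑ p, ∑ c, ent (heckeR q r) p x c l • f p c =
      coeffM q r x l • f x l + coeffL q l x • f l x := by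
  simp only [ent_heckeR, add_smul, ite_smul, zero_smul, Finset.sum_add_distrib, ite_and,
    Finset.sum_ite_eq', Finset.sum_ite_irrel, Finset.sum_const_zero, Finset.mem_univ, if_true]

theorem sum_coeffL_smul (f : Fin n → M) (x : Fin n) :
    ∑ j, coeffL q j x • f j = mu q • ∑ j ∈ Finset.Iio x, f j := by
  simp only [coeffL, theta, ite_mul, one_mul, zero_mul, ite_smul, zero_smul]
  rw [← Finset.sum_filter, Finset.smul_sum]
  congr 1
  ext a
  simp

/-- In this contraction the `L` part becomes a partial trace over `j < x`; it is the origin of all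
sums over `a < i` in the relations. -/
theorem sum_heckeR_contract (f : Fin n → Fin n → M) (x y : Fin n) :
    ∑ j, ∑ k, ent (heckeR q r) j x y k • f j k =
      coeffM q r x y • f x y + if x = y then mu q • ∑ j ∈ Finset.Iio x, f j j else 0 := by
  rw [← sum_coeffL_smul]
  simp only [ent_heckeR, add_smul, ite_smul, zero_smul, Finset.sum_add_distrib, ite_and,
    Finset.sum_ite_eq', Finset.sum_ite_eq, Finset.sum_ite_irrel, Finset.sum_const_zero,
    Finset.mem_univ, if_true, eq_comm (a := y)]
  congr 1
  split_ifs with h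
  · subst h; rfl
  · rfl

/-- The contraction of `R` with the two inner indices of a monomial. -/
def contracted (m : Fin n → Fin n → Fin n → Fin n → M) (a b c d : Fin n) : M :=
  coeffM q r b c • m a b c d + if b = c then mu q • ∑ e ∈ Finset.Iio b, m a e e d else 0

/-- The explicit form of the reflection relation of the Hecke R-matrix. -/
def reflector (m : Fin n → Fin n → Fin n → Fin n → M) (u v x l : Fin n) : M :=
  coeffM q r u v • contracted q r m v x u l + coeffL q u v • contracted q r m u x v l -
    (coeffM q r x l • contracted q r m u l v x + coeffL q l x • contracted q r m u x v l)

variable {q r}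

theorem breflects_heckeR_iff (m : Fin n → Fin n → Fin n → Fin n → M) :
    BReflects (heckeR q r) m ↔ ∀ u v x l, reflector q r m u v x l = 0 := by
  simp only [BReflects, reflector, contracted]
  refine forall_congr' fun u => forall_congr' fun v => forall_congr' fun x => forall_congr' fun l => ?_
  rw [sub_eq_zero]
  refine Eq.congr ?_ ?_
  · rw [sum_heckeR_swap q r (fun y i => ∑ j, ∑ k, ent (heckeR q r) j x y k • m i j k l),
      sum_heckeR_contract, sum_heckeR_contract]
  · rw [sum_heckeR_swap' q r (fun p c => ∑ s, ∑ o, ent (heckeR q r) s c v o • m u s o p),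
      sum_heckeR_contract, sum_heckeR_contract]

end Explicit

/-! ### Comparison of the entries of the reflection relation with the listed relations -/

section Relators

variable {M : Type*} [AddCommGroup M] [Module 𝕜 M] {q : 𝕜} {r : Fin n → Fin n → 𝕜}
  {m : Fin n → Fin n → Fin n → Fin n → M}

theorem coeffL_of_lt (q : 𝕜) {i j : Fin n} (h : i < j) : coeffL q i j = mu q := by
  simp [coeffL, theta, h]

theorem coeffL_self (q : 𝕜) (i : Fin n) : coeffL q i i = 0 := coeffL_eq_zero q le_rfl

theorem theta_eq_zero {i j : Fin n} (h : i ≤ j) : theta 𝕜 i j = 0 := by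
  simp [theta, h.not_gt]

theorem contracted_of_ne {b c : Fin n} (h : b ≠ c) (a d : Fin n) :
    contracted q r m a b c d = coeffM q r b c • m a b c d := by
  simp [contracted, h]

theorem contracted_self (a b d : Fin n) :
    contracted q r m a b b d = q • m a b b d + mu q • ∑ e ∈ Finset.Iio b, m a e e d := by
  simp [contracted, coeffM_self]

/-! ### Symmetries of the reflection relation -/

theorem reflector_diag (u x : Fin n) : reflector q r m u u x x = 0 := by
  simp [reflector, coeffM_self, coeffL_self]

/-- The factor `L_{xl} - q` is `-q⁻¹` or `-q`, according to the order of `x` and `l`; these values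
come from `μ - q = -q⁻¹`. -/
theorem reflector_row (hq : q ≠ 0) (hr : ∀ i j, i < j → r i j ≠ 0) {u x l : Fin n} (h : x ≠ l) :
    reflector q r m u u l x =
      ((coeffL q x l - q) * coeffM q r l x) • reflector q r m u u x l := by
  have := coeffM_ne_zero hq hr x l
  simp only [reflector, coeffM_self, coeffL_self, coeffM_swap h]
  rcases h.lt_or_gt with h | h <;> simp only [coeffL_of_lt q h, coeffL_eq_zero q h.le, mu] <;>
    match_scalars <;> field_simp <;> ring

theorem reflector_col (hq : q ≠ 0) (hr : ∀ i j, i < j → r i j ≠ 0) {u v x : Fin n} (h : u ≠ v) :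
    reflector q r m v u x x =
      ((coeffL q v u - q) * coeffM q r v u) • reflector q r m u v x x := by
  have := coeffM_ne_zero hq hr u v
  simp only [reflector, coeffM_self, coeffL_self, coeffM_swap h]
  rcases h.lt_or_gt with h | h <;> simp only [coeffL_of_lt q h, coeffL_eq_zero q h.le, mu] <;>
    match_scalars <;> field_simp <;> ring

/-- This reduces the entries with first index below the second to those in the opposite order. -/
theorem reflector_swap (hq : q ≠ 0) (hr : ∀ i j, i < j → r i j ≠ 0) {u v x l : Fin n}
    (huv : u < v) (hxl : x ≠ l) :
    reflector q r m u v x l =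
      -(coeffM q r x l * coeffM q r u v) • reflector q r m v u l x +
        (coeffL q x l * coeffM q r u v) • reflector q r m v u x l := by
  have := coeffM_ne_zero hq hr u v
  have := coeffM_ne_zero hq hr x l
  simp only [reflector, coeffL_of_lt q huv, coeffL_eq_zero q huv.le, coeffM_swap huv.ne,
    coeffM_swap hxl]
  rcases hxl.lt_or_gt with h | h <;> simp only [coeffL_of_lt q h, coeffL_eq_zero q h.le] <;>
    match_scalars <;> field_simp <;> ring

/-! ### The listed relations as multiples of entries of the reflection relation -/

variable (hq : q ≠ 0) (hr : ∀ i j, i < j → r i j ≠ 0)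
include hq hr

theorem relator_i {i k : Fin n} (h : i < k) :
    relator q r m (.i i k h) = reflector q r m k i i k := by
  have := coeffM_ne_zero hq hr i k
  simp only [relator, reflector, coeffL_eq_zero q h.le, contracted_of_ne h.ne,
    contracted_of_ne h.ne', coeffM_swap h.ne]
  match_scalars <;> field_simp
  ring

/-- Common source of `iia` to `iid`: the position of `k` and `l` relative to `i` makes `L_{ik} -
L_{il}` equal to `0`, `0`, `-μ`, `μ` respectively. -/
theorem reflector_inner {i k l : Fin n} (hki : k ≠ i) (hli : l ≠ i) (hkl : k ≠ l) :
    -(coeffM q r k i * coeffM q r i l) • reflector q r m i k l i = m i i k l - m k l i i -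
      ((coeffL q i k - coeffL q i l) * (coeffM q r k i * coeffM q r i l * coeffM q r l k)) •
        m i l k i := by
  have := coeffM_ne_zero hq hr i k
  have := coeffM_ne_zero hq hr i l
  have := coeffM_ne_zero hq hr l k
  simp only [reflector, contracted_of_ne hli, contracted_of_ne hkl.symm, contracted_of_ne hki.symm,
    coeffM_swap hli.symm, coeffM_swap hki.symm]
  match_scalars <;> field_simp

theorem relator_iia {i k l : Fin n} (hkl : k ≠ l) (hk : i < k) (hl : i < l) :
    relator q r m (.iia i k l hkl hk hl) =
      -(coeffM q r k i * coeffM q r i l) • reflector q r m i k l i := by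
  rw [reflector_inner hq hr hk.ne' hl.ne' hkl]
  simp [relator, coeffL_of_lt q hk, coeffL_of_lt q hl]

theorem relator_iib {i k l : Fin n} (hkl : k ≠ l) (hk : k < i) (hl : l < i) :
    relator q r m (.iib i k l hkl hk hl) =
      -(coeffM q r k i * coeffM q r i l) • reflector q r m i k l i := by
  rw [reflector_inner hq hr hk.ne hl.ne hkl]
  simp [relator, coeffL_eq_zero q hk.le, coeffL_eq_zero q hl.le]

theorem relator_iic {i k l : Fin n} (hl : i < l) (hk : k < i) :
    relator q r m (.iic i k l hl hk) =
      -(coeffM q r k i * coeffM q r i l) • reflector q r m i k l i := by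
  rw [reflector_inner hq hr hk.ne hl.ne' (hk.trans hl).ne]
  simp only [relator, coeffL_eq_zero q hk.le, coeffL_of_lt q hl,
    cocycleBar_eq hq hr hk.ne hl.ne (hk.trans hl).ne]
  module

theorem relator_iid {i k l : Fin n} (hk : i < k) (hl : l < i) :
    relator q r m (.iid i k l hk hl) =
      -(coeffM q r k i * coeffM q r i l) • reflector q r m i k l i := by
  rw [reflector_inner hq hr hk.ne' hl.ne (hl.trans hk).ne']
  simp only [relator, coeffL_eq_zero q hl.le, coeffL_of_lt q hk,
    cocycleBar_eq hq hr hl.ne' (hl.trans hk).ne hk.ne]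
  module

theorem relator_iie {i l : Fin n} (h : i < l) :
    relator q r m (.iie i l h) = (q⁻¹ ^ 2) • reflector q r m i i i l := by
  have := coeffM_ne_zero hq hr i l
  simp only [relator, reflector, coeffL_self, coeffL_eq_zero q h.le, contracted_self,
    contracted_of_ne h.ne', coeffM_self, coeffM_swap h.ne, mu]
  match_scalars <;> field_simp <;> ring

theorem relator_iif {i l : Fin n} (h : l < i) :
    relator q r m (.iif i l h) = reflector q r m i i i l := by
  have := coeffM_ne_zero hq hr i l
  simp only [relator, reflector, coeffL_self, coeffL_of_lt q h, contracted_self,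
    contracted_of_ne h.ne, coeffM_self, coeffM_swap h.ne', mu]
  match_scalars <;> field_simp <;> ring

theorem relator_iig {i k : Fin n} (h : k < i) :
    relator q r m (.iig i k h) = reflector q r m k i i i := by
  have := coeffM_ne_zero hq hr i k
  simp only [relator, reflector, coeffL_self, coeffL_of_lt q h, contracted_self,
    contracted_of_ne h.ne', coeffM_self, coeffM_swap h.ne', mu]
  match_scalars <;> field_simp <;> ring

theorem relator_iih {i k : Fin n} (h : i < k) :
    relator q r m (.iih i k h) = reflector q r m k i i i := by
  have := coeffM_ne_zero hq hr i k
  simp only [relator, reflector, coeffL_self, coeffL_eq_zero q h.le, contracted_self,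
    contracted_of_ne h.ne, coeffM_self, coeffM_swap h.ne, mu]
  match_scalars <;> field_simp <;> ring

theorem relator_iiia {i j k l : Fin n}
    (hij : i ≠ j) (hil : i ≠ l) (hjk : j ≠ k) (hjl : j ≠ l) (hkl : k ≠ l) (h : i < k) :
    relator q r m (.iiia i j k l hij hil hjk hjl hkl h) =
      (coeffM q r i k * coeffM q r k j) • reflector q r m k i j l := by
  have := coeffM_ne_zero hq hr i k
  have := coeffM_ne_zero hq hr j k
  have := coeffM_ne_zero hq hr i j
  simp only [relator, reflector, theta_eq_zero h.le, contracted_of_ne hjk,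
    contracted_of_ne hij.symm, contracted_of_ne hil.symm,
    cocycle_eq hq hr hij hjk h.ne, cocycleBar_eq hq hr hij hjl hil, coeffM_swap h.ne,
    coeffM_swap hjk, coeffM_swap hij, coeffL]
  match_scalars <;> field_simp
  ring

theorem relator_iiib {i j l : Fin n} (hij : i ≠ j) (hil : i ≠ l) (h : j < l) :
    relator q r m (.iiib i j l hij hil h) = coeffM q r i j • reflector q r m i i j l := by
  have := coeffM_ne_zero hq hr i j
  simp only [relator, reflector, coeffL_eq_zero q h.le, contracted_of_ne hij.symm,
    contracted_of_ne hil.symm, coeffM_self, coeffL_self,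
    cocycleBar_eq hq hr hij h.ne hil, coeffM_swap hij]
  match_scalars <;> field_simp
  ring

theorem relator_iiic {i j k : Fin n} (hij : i ≠ j) (hjk : j ≠ k) (h : i < k) :
    relator q r m (.iiic i j k hij hjk h) =
      (coeffM q r i k * coeffM q r k j) • reflector q r m k i j j := by
  have := coeffM_ne_zero hq hr i k
  have := coeffM_ne_zero hq hr j k
  simp only [relator, reflector, coeffL_eq_zero q h.le, contracted_of_ne hij.symm,
    contracted_of_ne hjk, coeffM_self, coeffL_self,
    cocycle_eq hq hr hij hjk h.ne, coeffM_swap h.ne, coeffM_swap hjk]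
  match_scalars <;> field_simp
  ring

theorem relator_iiid {i j l : Fin n} (hil : i ≠ l) (hjl : j ≠ l) (h : i < j) :
    relator q r m (.iiid i j l hil hjl h) = coeffM q r i j • reflector q r m j i j l := by
  have := coeffM_ne_zero hq hr i j
  simp only [relator, reflector, theta_eq_zero h.le, contracted_self, contracted_of_ne h.ne',
    contracted_of_ne hil.symm, cocycleBar_eq hq hr hjl hil.symm h.ne', coeffM_swap h.ne, coeffL]
  match_scalars <;> field_simp
  ring

theorem relator_iiie {i j k : Fin n} (hij : i ≠ j) (hjk : j ≠ k) (h : i < k) :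
    relator q r m (.iiie i j k hij hjk h) = coeffM q r i j • reflector q r m k i j i := by
  have := coeffM_ne_zero hq hr i j
  simp only [relator, reflector, theta_eq_zero h.le, contracted_self, contracted_of_ne hjk,
    contracted_of_ne hij.symm, cocycleBar_eq hq hr hij hjk h.ne, coeffM_swap hij, coeffL]
  match_scalars <;> field_simp
  ring

omit hr in
-- The partial sums `S_i` of `f` satisfy `S_{i+1} = g_i + (1 - q⁻¹μ) S_i = g_i + q⁻² S_i`. This is
-- where the weights `q^{2(a-i)}` in `iiif` come from.
theorem sum_Iio_recursion (f g : Fin n → M) (i : Fin n)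
    (h : ∀ a < i, f a = g a - (q⁻¹ * mu q) • ∑ b ∈ Finset.Iio a, f b) :
    ∑ a ∈ Finset.Iio i, f a =
      q ^ 2 • ∑ a ∈ Finset.Iio i, q ^ (2 * ((a : ℤ) - (i : ℤ))) • g a := by
  obtain ⟨k, hk⟩ := i
  induction k with
  | zero =>
    have : Finset.Iio (⟨0, hk⟩ : Fin n) = ∅ := by ext a; simp [Fin.lt_def]
    simp [this]
  | succ k ih =>
    have hins : Finset.Iio (⟨k + 1, hk⟩ : Fin n) = insert ⟨k, by omega⟩
        (Finset.Iio (⟨k, by omega⟩ : Fin n)) := by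
      ext a
      simp only [Finset.mem_Iio, Finset.mem_insert, Fin.lt_def, Fin.ext_iff]
      omega
    have hlt : (⟨k, by omega⟩ : Fin n) < ⟨k + 1, hk⟩ := by simp [Fin.lt_def]
    have ih := ih (by omega) fun a ha => h a (ha.trans hlt)
    have e1 : ∀ e : ℤ, q ^ (2 * (e - ((k + 1 : ℕ) : ℤ))) = q⁻¹ ^ 2 * q ^ (2 * (e - (k : ℤ))) := by
      intro e
      have : (2 * (e - ((k + 1 : ℕ) : ℤ))) = 2 * (e - (k : ℤ)) - 2 := by push_cast; ring
      rw [this, zpow_sub₀ hq, inv_pow, div_eq_inv_mul, zpow_ofNat]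
    rw [hins, Finset.sum_insert (by simp), Finset.sum_insert (by simp), h _ hlt]
    simp only [e1, ← smul_smul (q⁻¹ ^ 2)]
    simp only [← Finset.smul_sum]
    rw [smul_add, smul_comm (q ^ 2) (q⁻¹ ^ 2) (∑ a ∈ _, _), ← ih]
    simp only [sub_self, mul_zero, zpow_zero, mu]
    match_scalars <;> field_simp
    ring

/-- The entry `i j i j` contains the sum of `X^j_a X^a_j` over `a < i`, absent from the listed
relation. The entries `a j a j` with `a < i` form a recursion for these monomials, and its solution
is substituted. Hence the identity holds only modulo those entries and the commutation of diagonal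
generators. -/
theorem relator_iiif {i j : Fin n} (h : i < j) (hc : ∀ a ≤ i, m j j a a = m a a j j)
    (hE : ∀ a < i, reflector q r m a j a j = 0) :
    relator q r m (.iiif i j h) = -(q⁻¹ * coeffM q r j i) • reflector q r m i j i j := by
  have expl (a : Fin n) (ha : a < j) : (q⁻¹ * coeffM q r j a) • reflector q r m a j a j =
      m j a a j - (m a j j a - (q⁻¹ * mu q) • m a a j j +
        (q⁻¹ * mu q) • ∑ b ∈ Finset.Iio j, m a b b a - (q⁻¹ * mu q) •
          ∑ b ∈ Finset.Iio a, m j b b j) := by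
    have := coeffM_ne_zero hq hr a j
    simp only [reflector, coeffL_eq_zero q ha.le, contracted_self, contracted_of_ne ha.ne,
      coeffL_of_lt q ha, coeffM_swap ha.ne]
    match_scalars <;> field_simp
    ring
  have hS := sum_Iio_recursion hq (fun a => m j a a j) (fun a => m a j j a -
    (q⁻¹ * mu q) • m a a j j + (q⁻¹ * mu q) • ∑ b ∈ Finset.Iio j, m a b b a) i (fun a ha => by
      have := expl a (ha.trans h)
      rw [hE a ha, smul_zero] at this
      exact sub_eq_zero.1 this.symm)
  have hS' : ∑ a ∈ Finset.Iio i, q ^ (2 * ((a : ℤ) - (i : ℤ))) • (m a j j a -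
      (q⁻¹ * mu q) • m a a j j + (q⁻¹ * mu q) • ∑ b ∈ Finset.Iio j, m a b b a) =
      ∑ a ∈ Finset.Iio i, q ^ (2 * ((a : ℤ) - (i : ℤ))) • m a j j a -
      (q⁻¹ * mu q) • ∑ a ∈ Finset.Iio i, q ^ (2 * ((a : ℤ) - (i : ℤ))) • m a a j j +
      (q⁻¹ * mu q) • ∑ b ∈ Finset.Iio j, ∑ a ∈ Finset.Iio i,
        q ^ (2 * ((a : ℤ) - (i : ℤ))) • m a b b a := by
    rw [Finset.sum_comm]
    simp only [← Finset.smul_sum, smul_add, smul_sub, Finset.sum_add_distrib,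
      Finset.sum_sub_distrib, smul_comm _ (q⁻¹ * mu q)]
  have hc' : ∑ a ∈ Finset.Iio i, q ^ (2 * ((a : ℤ) - (i : ℤ))) • m j j a a =
      ∑ a ∈ Finset.Iio i, q ^ (2 * ((a : ℤ) - (i : ℤ))) • m a a j j :=
    Finset.sum_congr rfl fun a ha => by rw [hc a (Finset.mem_Iio.1 ha).le]
  simp only [relator, neg_smul, expl i h, hS, hS', hc i le_rfl, hc']
  match_scalars <;> field_simp

/-- The reflection relation is equivalent to the explicit list of relations. -/
theorem breflects_iff_relator :
    BReflects (heckeR q r) m ↔ ∀ c, relator q r m c = 0 := by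
  rw [breflects_heckeR_iff]
  constructor
  · intro H c
    have hcomm {a j : Fin n} (h : a < j) : m j j a a = m a a j j := by
      have := relator_i (m := m) hq hr h
      rw [H] at this
      exact (sub_eq_zero.1 this).symm
    cases c with
    | i i k h => rw [relator_i hq hr, H]
    | iia i k l hkl hk hl => rw [relator_iia hq hr, H, smul_zero]
    | iib i k l hkl hk hl => rw [relator_iib hq hr, H, smul_zero]
    | iic i k l hl hk => rw [relator_iic hq hr, H, smul_zero]
    | iid i k l hk hl => rw [relator_iid hq hr, H, smul_zero]
    | iie i l h => rw [relator_iie hq hr, H, smul_zero]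
    | iif i l h => rw [relator_iif hq hr, H]
    | iig i k h => rw [relator_iig hq hr, H]
    | iih i k h => rw [relator_iih hq hr, H]
    | iiia i j k l hij hil hjk hjl hkl h => rw [relator_iiia hq hr, H, smul_zero]
    | iiib i j l hij hil h => rw [relator_iiib hq hr, H, smul_zero]
    | iiic i j k hij hjk h => rw [relator_iiic hq hr, H, smul_zero]
    | iiid i j l hil hjl h => rw [relator_iiid hq hr, H, smul_zero]
    | iiie i j k hij hjk h => rw [relator_iiie hq hr, H, smul_zero]
    | iiif i j h =>
      rw [relator_iiif hq hr h (fun a ha => hcomm (ha.trans_lt h)) fun a _ => H _ _ _ _, H,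
        smul_zero]
  · intro H
    have ne := coeffM_ne_zero hq hr
    -- Each listed relation is an invertible multiple of an entry, so its vanishing passes to the
    -- entry.
    have cancel {a : 𝕜} {x y : M} (ha : a ≠ 0) (hx : x = 0) (h : x = a • y) : y = 0 :=
      (smul_eq_zero.1 (h.symm.trans hx)).resolve_left ha
    have hcomm {a j : Fin n} (h : a < j) : m j j a a = m a a j j :=
      (sub_eq_zero.1 (H (.i a j h))).symm
    have hi {i k : Fin n} (h : i < k) : reflector q r m k i i k = 0 := by
      rw [← relator_i hq hr h, H]
    have hii {i k l : Fin n} (hki : k ≠ i) (hli : l ≠ i) (hkl : k ≠ l) :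
        reflector q r m i k l i = 0 := by
      have h0 : -(coeffM q r k i * coeffM q r i l) ≠ 0 := neg_ne_zero.2 (mul_ne_zero (ne _ _) (ne _ _))
      rcases hki.lt_or_gt with h1 | h1 <;> rcases hli.lt_or_gt with h2 | h2
      · exact cancel h0 (H _) (relator_iib hq hr hkl h1 h2)
      · exact cancel h0 (H _) (relator_iic hq hr h2 h1)
      · exact cancel h0 (H _) (relator_iid hq hr h1 h2)
      · exact cancel h0 (H _) (relator_iia hq hr hkl h1 h2)
    have hrow {u x l : Fin n} (h : x < l) : reflector q r m u u x l = 0 := by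
      by_cases hx : u = x
      · subst hx
        exact cancel (pow_ne_zero 2 (inv_ne_zero hq)) (H _) (relator_iie hq hr h)
      by_cases hl : u = l
      · subst hl
        rw [reflector_row hq hr h.ne', ← relator_iif hq hr h, H, smul_zero]
      · exact cancel (ne _ _) (H _) (relator_iiib hq hr hx hl h)
    have hcol {u v x : Fin n} (h : v < u) : reflector q r m u v x x = 0 := by
      by_cases hv : x = v
      · subst hv
        rw [← relator_iih hq hr h, H]
      by_cases hu : x = u
      · subst hu
        rw [reflector_col hq hr h.ne, ← relator_iig hq hr h, H, smul_zero]
      · exact cancel (mul_ne_zero (ne _ _) (ne _ _)) (H _) (relator_iiic hq hr (Ne.symm hv) hu h)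
    have hpair {i j : Fin n} (h : i < j) : reflector q r m i j i j = 0 := by
      -- `relator_iiif` at `i` presupposes the vanishing of the entries `a j a j` for all `a < i`.
      induction i using WellFoundedLT.induction with
      | ind i ih =>
        exact cancel (neg_ne_zero.2 (mul_ne_zero (inv_ne_zero hq) (ne _ _))) (H _)
          (relator_iiif hq hr h (fun a ha => hcomm (ha.trans_lt h)) fun a ha => ih a ha (ha.trans h))
    have hgen {u v x l : Fin n} (h : v < u) (hxl : x ≠ l) : reflector q r m u v x l = 0 := by
      have hiiie {x : Fin n} (hu : x ≠ u) (hv : x ≠ v) : reflector q r m u v x v = 0 :=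
        cancel (ne _ _) (H _) (relator_iiie hq hr hv.symm hu h)
      -- Where only the swapped entry is available from the list, this identity is solved for the
      -- entry `u v x l`, whose coefficient is a product of nonzero `M`s.
      have hsw := reflector_swap (m := m) hq hr h hxl.symm
      by_cases hxu : x = u
      · subst hxu
        by_cases hlv : l = v
        · subst hlv
          rw [hpair h, hi h, smul_zero, add_zero] at hsw
          exact cancel (neg_ne_zero.2 (mul_ne_zero (ne _ _) (ne _ _))) rfl hsw
        · exact cancel (ne _ _) (H _) (relator_iiid hq hr (Ne.symm hlv) hxl h)
      by_cases hlu : l = u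
      · subst hlu
        by_cases hxv : x = v
        · subst hxv
          exact hi h
        · exact hii h.ne hxu (Ne.symm hxv)
      by_cases hxv : x = v
      · subst hxv
        rw [hii h.ne' (Ne.symm hxl) (Ne.symm hlu), hiiie hlu (Ne.symm hxl), smul_zero,
          add_zero] at hsw
        exact cancel (neg_ne_zero.2 (mul_ne_zero (ne _ _) (ne _ _))) rfl hsw
      by_cases hlv : l = v
      · subst hlv
        exact hiiie hxu hxv
      · exact cancel (mul_ne_zero (ne _ _) (ne _ _)) (H _)
          (relator_iiia hq hr (Ne.symm hxv) (Ne.symm hlv) hxu hxl (Ne.symm hlu) h)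
    intro u v x l
    rcases eq_or_ne x l with rfl | hxl
    · rcases lt_trichotomy u v with h | rfl | h
      · rw [reflector_col hq hr h.ne', hcol h, smul_zero]
      · exact reflector_diag u x
      · exact hcol h
    · rcases lt_trichotomy u v with h | rfl | h
      · rw [reflector_swap hq hr h hxl, hgen h hxl.symm, hgen h hxl, smul_zero, smul_zero, add_zero]
      · rcases hxl.lt_or_gt with h | h
        · exact hrow h
        · rw [reflector_row hq hr h.ne, hrow h, smul_zero]
      · exact hgen h hxl

end Relators

/-! ### The number of relations -/

/-- The pair of generators that a relation commutes past each other. -/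
def relPair : RelIndex n → (Fin n × Fin n) × (Fin n × Fin n)
  | .i i k _ => ((i, i), (k, k))
  | .iia i k l _ _ _ => ((i, i), (k, l))
  | .iib i k l _ _ _ => ((i, i), (k, l))
  | .iic i k l _ _ => ((i, i), (k, l))
  | .iid i k l _ _ => ((i, i), (k, l))
  | .iie i l _ => ((i, i), (i, l))
  | .iif i l _ => ((i, i), (i, l))
  | .iig i k _ => ((i, i), (k, i))
  | .iih i k _ => ((i, i), (k, i))
  | .iiia i j k l _ _ _ _ _ _ => ((i, j), (k, l))
  | .iiib i j l _ _ _ => ((i, j), (i, l))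
  | .iiic i j k _ _ _ => ((i, j), (k, j))
  | .iiid i j l _ _ _ => ((i, j), (j, l))
  | .iiie i j k _ _ _ => ((i, j), (k, i))
  | .iiif i j _ => ((i, j), (j, i))

theorem relPair_ne (c : RelIndex n) : (relPair c).1 ≠ (relPair c).2 := by
  cases c <;> simp only [relPair, ne_eq, Prod.mk.injEq] <;> omega

theorem relPair_injective : Function.Injective (relPair (n := n)) := by
  intro c c' h
  cases c <;> cases c' <;> simp only [relPair, Prod.mk.injEq] at h <;> grind

theorem relPair_ne_swap (c c' : RelIndex n) : relPair c ≠ (relPair c').swap := by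
  intro h
  cases c <;> cases c' <;> simp only [relPair, Prod.swap, Prod.mk.injEq] at h <;> omega

theorem exists_relPair_of_diag {i k l : Fin n} (hkl : k ≠ l) :
    ∃ c : RelIndex n, relPair c = ((i, i), (k, l)) := by
  rcases lt_trichotomy k i with hk | rfl | hk
  · rcases lt_trichotomy l i with hl | rfl | hl
    · exact ⟨.iib i k l hkl hk hl, rfl⟩
    · exact ⟨.iig l k hk, rfl⟩
    · exact ⟨.iic i k l hl hk, rfl⟩
  · rcases hkl.lt_or_gt with hl | hl
    · exact ⟨.iie k l hl, rfl⟩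
    · exact ⟨.iif k l hl, rfl⟩
  · rcases lt_trichotomy l i with hl | rfl | hl
    · exact ⟨.iid i k l hk hl, rfl⟩
    · exact ⟨.iih l k hk, rfl⟩
    · exact ⟨.iia i k l hkl hk hl, rfl⟩

theorem exists_relPair_of_lt {i j k l : Fin n} (hij : i ≠ j) (hkl : k ≠ l) (h : i < k) :
    ∃ c : RelIndex n, relPair c = ((i, j), (k, l)) := by
  rcases eq_or_ne j l with rfl | hjl
  · exact ⟨.iiic i j k hij hkl.symm h, rfl⟩
  rcases eq_or_ne j k with rfl | hjk
  · rcases eq_or_ne i l with rfl | hil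
    · exact ⟨.iiif i j h, rfl⟩
    · exact ⟨.iiid i j l hil hkl h, rfl⟩
  rcases eq_or_ne i l with rfl | hil
  · exact ⟨.iiie i j k hij hjk h, rfl⟩
  · exact ⟨.iiia i j k l hij hil hjk hjl hkl h, rfl⟩

theorem exists_relPair {x y : Fin n × Fin n} (h : x ≠ y) :
    ∃ c : RelIndex n, relPair c = (x, y) ∨ relPair c = (y, x) := by
  obtain ⟨i, j⟩ := x
  obtain ⟨k, l⟩ := y
  rcases eq_or_ne k l with rfl | hkl
  · rcases eq_or_ne i j with rfl | hij
    · rcases lt_trichotomy i k with h1 | rfl | h1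
      · exact ⟨.i i k h1, .inl rfl⟩
      · exact absurd rfl h
      · exact ⟨.i k i h1, .inr rfl⟩
    · exact (exists_relPair_of_diag hij).imp fun _ => .inr
  rcases eq_or_ne i j with rfl | hij
  · exact (exists_relPair_of_diag hkl).imp fun _ => .inl
  rcases lt_trichotomy i k with h1 | rfl | h1
  · exact (exists_relPair_of_lt hij hkl h1).imp fun _ => .inl
  · rcases lt_trichotomy j l with h2 | rfl | h2
    · exact ⟨.iiib i j l hij hkl h2, .inl rfl⟩
    · exact absurd rfl h
    · exact ⟨.iiib i l j hkl hij h2, .inr rfl⟩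
  · exact (exists_relPair_of_lt hkl hij h1).imp fun _ => .inr

/-- `relPair` picks exactly one ordering of each unordered pair of distinct generators, so the
relations biject with the off-diagonal part of `Sym2`. -/
theorem card_relIndex (n : ℕ) : Nat.card (RelIndex n) = (n ^ 2).choose 2 := by
  let f : RelIndex n → {e : Sym2 (Fin n × Fin n) // ¬ e.IsDiag} := fun c =>
    ⟨s((relPair c).1, (relPair c).2), by simpa using relPair_ne c⟩
  have hf : Function.Bijective f := by
    constructor
    · intro c c' h
      rcases Sym2.mk_eq_mk_iff.1 (Subtype.ext_iff.1 h) with h | h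
      · exact relPair_injective h
      · exact absurd h (relPair_ne_swap c c')
    · rintro ⟨e, he⟩
      induction e with
      | _ x y =>
        obtain ⟨c, hc | hc⟩ := exists_relPair (x := x) (y := y) (by simpa using he)
        · exact ⟨c, Subtype.ext (by simp [f, hc])⟩
        · exact ⟨c, Subtype.ext (by simp [f, hc, Sym2.eq_swap])⟩
  rw [Nat.card_congr (Equiv.ofBijective f hf), Nat.card_eq_fintype_card,
    Sym2.card_subtype_not_diag]
  simp [sq]

/-! ### Linear independence -/

/-- In a vanishing combination take a nonzero coefficient of maximal rank; the functional attached
to it kills all other terms present. Terms of equal rank must be killed too, so `rk` need not be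
injective. -/
theorem linearIndependent_of_triangular {ι V : Type*} [AddCommGroup V] [Module 𝕜 V] (v : ι → V)
    (f : ι → V →ₗ[𝕜] 𝕜) (rk : ι → ℕ) (h1 : ∀ c, f c (v c) ≠ 0)
    (h2 : ∀ c c', c ≠ c' → rk c' ≤ rk c → f c (v c') = 0) : LinearIndependent 𝕜 v := by
  classical
  rw [linearIndependent_iff']
  intro s g hg
  by_contra! H
  obtain ⟨c₀, hc₀, hg₀⟩ := H
  obtain ⟨c, hc, hmax⟩ := (s.filter fun c => g c ≠ 0).exists_max_image rk
    ⟨c₀, Finset.mem_filter.2 ⟨hc₀, hg₀⟩⟩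
  rw [Finset.mem_filter] at hc
  have h3 := congrArg (f c) hg
  rw [map_sum, Finset.sum_eq_single c, map_smul, map_zero, smul_eq_mul, mul_eq_zero] at h3
  · exact h3.elim hc.2 (h1 c)
  · intro b hb hbc
    by_cases hgb : g b = 0
    · simp [hgb]
    · rw [map_smul, h2 c b hbc.symm (hmax b (Finset.mem_filter.2 ⟨hb, hgb⟩)), smul_zero]
  · exact fun h => absurd hc.1 h

/-- A monomial characterising a relation. -/
def relLead : RelIndex n → Fin n × Fin n × Fin n × Fin n
  | .i i k _ => (i, i, k, k)
  | .iia i k l _ _ _ => (i, i, k, l)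
  | .iib i k l _ _ _ => (k, l, i, i)
  | .iic i k l _ _ => (k, l, i, i)
  | .iid i k l _ _ => (i, i, k, l)
  | .iie i l _ => (i, l, i, i)
  | .iif i l _ => (i, l, i, i)
  | .iig i k _ => (i, i, k, i)
  | .iih i k _ => (i, i, k, i)
  | .iiia i j k l _ _ _ _ _ _ => (i, j, k, l)
  | .iiib i j l _ _ _ => (i, j, i, l)
  | .iiic i j k _ _ _ => (i, j, k, j)
  | .iiid i j l _ _ _ => (j, l, i, j)
  | .iiie i j k _ _ _ => (i, j, k, i)
  | .iiif i j _ => (j, i, i, j)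

/-- The leading monomial of a relation only occurs in relations of larger level: those of `iiid`
and `iiie` occur in `iic` and `iid`, and that of `iiif i j` occurs in `iiif i' j'` for `i < i'`. -/
def relLevel : RelIndex n → ℕ
  | .iic _ _ _ _ _ => 1
  | .iid _ _ _ _ _ => 1
  | .iiif i _ _ => i
  | _ => 0

/-- The monomials occurring in a relation. -/
def RelOccurs (x : Fin n × Fin n × Fin n × Fin n) : RelIndex n → Prop
  | .i i k _ => x = (i, i, k, k) ∨ x = (k, k, i, i)
  | .iia i k l _ _ _ => x = (i, i, k, l) ∨ x = (k, l, i, i)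
  | .iib i k l _ _ _ => x = (i, i, k, l) ∨ x = (k, l, i, i)
  | .iic i k l _ _ => x = (i, i, k, l) ∨ x = (k, l, i, i) ∨ x = (i, l, k, i)
  | .iid i k l _ _ => x = (i, i, k, l) ∨ x = (k, l, i, i) ∨ x = (i, l, k, i)
  | .iie i l _ => x = (i, i, i, l) ∨ x = (i, l, i, i) ∨ ∃ a < i, x = (i, a, a, l)
  | .iif i l _ => x = (i, i, i, l) ∨ x = (i, l, i, i) ∨ ∃ a < i, x = (i, a, a, l)
  | .iig i k _ => x = (i, i, k, i) ∨ x = (k, i, i, i) ∨ ∃ a < i, x = (k, a, a, i)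
  | .iih i k _ => x = (i, i, k, i) ∨ x = (k, i, i, i) ∨ ∃ a < i, x = (k, a, a, i)
  | .iiia i j k l _ _ _ _ _ _ => x = (i, j, k, l) ∨ x = (k, l, i, j) ∨ x = (k, j, i, l)
  | .iiib i j l _ _ _ => x = (i, j, i, l) ∨ x = (i, l, i, j)
  | .iiic i j k _ _ _ => x = (i, j, k, j) ∨ x = (k, j, i, j)
  | .iiid i j l _ _ _ => x = (i, j, j, l) ∨ x = (j, l, i, j) ∨ (∃ a < j, x = (i, a, a, l)) ∨
      (l < j ∧ x = (j, j, i, l))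
  | .iiie i j k _ _ _ => x = (i, j, k, i) ∨ x = (k, i, i, j) ∨ (∃ a < i, x = (k, a, a, j)) ∨
      (i < j ∧ x = (k, j, i, i))
  | .iiif i j _ => x = (i, j, j, i) ∨ x = (j, i, i, j) ∨ (∃ a < i, x = (a, j, j, a)) ∨
      x = (j, j, i, i) ∨ (∃ a < j, x = (i, a, a, i)) ∨ (∃ b < j, ∃ a < i, x = (a, b, b, a)) ∨
      ∃ a < i, x = (j, j, a, a)

/-- The side from which the leading monomial is taken matters. For `iie`, for instance, `X^i_i
X^i_l` can also occur in the sum of some `iiid`, whereas `X^i_l X^i_i` occurs nowhere else. -/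
theorem eq_of_relOccurs_relLead {c c' : RelIndex n} (h : RelOccurs (relLead c) c') :
    c = c' ∨ relLevel c < relLevel c' := by
  cases c <;> cases c' <;>
    simp only [RelOccurs, relLead, relLevel, Prod.mk.injEq] at h ⊢ <;> grind

section

variable {M : Type*} [AddCommGroup M] [Module 𝕜 M] {q : 𝕜} {r : Fin n → Fin n → 𝕜}

theorem relator_eq_zero_of_occurs {m : Fin n → Fin n → Fin n → Fin n → M} {c : RelIndex n}
    (h : ∀ i j k l, RelOccurs (i, j, k, l) c → m i j k l = 0) : relator q r m c = 0 := by
  cases c with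
  | i i k _ => simp [relator, h i i k k (.inl rfl), h k k i i (.inr rfl)]
  | iia i k l _ _ _ => simp [relator, h i i k l (.inl rfl), h k l i i (.inr rfl)]
  | iib i k l _ _ _ => simp [relator, h i i k l (.inl rfl), h k l i i (.inr rfl)]
  | iic i k l _ _ =>
    simp [relator, h i i k l (.inl rfl), h k l i i (.inr (.inl rfl)), h i l k i (.inr (.inr rfl))]
  | iid i k l _ _ =>
    simp [relator, h i i k l (.inl rfl), h k l i i (.inr (.inl rfl)), h i l k i (.inr (.inr rfl))]
  | iie i l _ =>
    have hs := Finset.sum_eq_zero (s := Finset.Iio i) (f := fun a => m i a a l) fun a ha =>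
      h i a a l (.inr (.inr ⟨a, Finset.mem_Iio.1 ha, rfl⟩))
    simp [relator, hs, h i i i l (.inl rfl), h i l i i (.inr (.inl rfl))]
  | iif i l _ =>
    have hs := Finset.sum_eq_zero (s := Finset.Iio i) (f := fun a => m i a a l) fun a ha =>
      h i a a l (.inr (.inr ⟨a, Finset.mem_Iio.1 ha, rfl⟩))
    simp [relator, hs, h i i i l (.inl rfl), h i l i i (.inr (.inl rfl))]
  | iig i k _ =>
    have hs := Finset.sum_eq_zero (s := Finset.Iio i) (f := fun a => m k a a i) fun a ha =>
      h k a a i (.inr (.inr ⟨a, Finset.mem_Iio.1 ha, rfl⟩))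
    simp [relator, hs, h i i k i (.inl rfl), h k i i i (.inr (.inl rfl))]
  | iih i k _ =>
    have hs := Finset.sum_eq_zero (s := Finset.Iio i) (f := fun a => m k a a i) fun a ha =>
      h k a a i (.inr (.inr ⟨a, Finset.mem_Iio.1 ha, rfl⟩))
    simp [relator, hs, h i i k i (.inl rfl), h k i i i (.inr (.inl rfl))]
  | iiia i j k l _ _ _ _ _ _ =>
    simp [relator, h i j k l (.inl rfl), h k l i j (.inr (.inl rfl)), h k j i l (.inr (.inr rfl))]
  | iiib i j l _ _ _ => simp [relator, h i j i l (.inl rfl), h i l i j (.inr rfl)]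
  | iiic i j k _ _ _ => simp [relator, h i j k j (.inl rfl), h k j i j (.inr rfl)]
  | iiid i j l _ _ _ =>
    have hs := Finset.sum_eq_zero (s := Finset.Iio j) (f := fun a => m i a a l) fun a ha =>
      h i a a l (.inr (.inr (.inl ⟨a, Finset.mem_Iio.1 ha, rfl⟩)))
    have ht : theta 𝕜 j l • m j j i l = 0 := by
      rcases lt_or_ge l j with hl | hl
      · rw [h j j i l (.inr (.inr (.inr ⟨hl, rfl⟩))), smul_zero]
      · rw [theta_eq_zero hl, zero_smul]
    simp [relator, hs, mul_smul, ht, h i j j l (.inl rfl), h j l i j (.inr (.inl rfl))]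
  | iiie i j k _ _ _ =>
    have hs := Finset.sum_eq_zero (s := Finset.Iio i) (f := fun a => m k a a j) fun a ha =>
      h k a a j (.inr (.inr (.inl ⟨a, Finset.mem_Iio.1 ha, rfl⟩)))
    have ht : theta 𝕜 j i • m k j i i = 0 := by
      rcases lt_or_ge i j with hl | hl
      · rw [h k j i i (.inr (.inr (.inr ⟨hl, rfl⟩))), smul_zero]
      · rw [theta_eq_zero hl, zero_smul]
    simp [relator, hs, mul_smul, ht, h i j k i (.inl rfl), h k i i j (.inr (.inl rfl))]
  | iiif i j hij =>
    have h1 : ∀ a ∈ Finset.Iio i, m a j j a = 0 := fun a ha =>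
      h a j j a (.inr (.inr (.inl ⟨a, Finset.mem_Iio.1 ha, rfl⟩)))
    have h2 : ∀ a ∈ Finset.Iio j, m i a a i = 0 := fun a ha =>
      h i a a i (.inr (.inr (.inr (.inr (.inl ⟨a, Finset.mem_Iio.1 ha, rfl⟩)))))
    have h3 : ∀ b ∈ Finset.Iio j, ∀ a ∈ Finset.Iio i, m a b b a = 0 := fun b hb a ha =>
      h a b b a (.inr (.inr (.inr (.inr (.inr (.inl
        ⟨b, Finset.mem_Iio.1 hb, a, Finset.mem_Iio.1 ha, rfl⟩))))))
    have h4 : ∀ a ∈ Finset.Iio i, m j j a a = 0 := fun a ha =>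
      h j j a a (.inr (.inr (.inr (.inr (.inr (.inr ⟨a, Finset.mem_Iio.1 ha, rfl⟩))))))
    simp only [relator, h i j j i (.inl rfl), h j i i j (.inr (.inl rfl)),
      h j j i i (.inr (.inr (.inr (.inl rfl)))), Finset.sum_eq_zero h2]
    rw [Finset.sum_eq_zero fun a ha => by rw [h1 a ha, smul_zero],
      Finset.sum_eq_zero fun b hb => Finset.sum_eq_zero fun a ha => by rw [h3 b hb a ha, smul_zero],
      Finset.sum_eq_zero fun a ha => by rw [h4 a ha, smul_zero]]
    simp

/-- Relators are natural in the target module; this carries them from `L ⊗ L` to coordinates,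
quotients and algebras. -/
theorem map_relator {N : Type*} [AddCommGroup N] [Module 𝕜 N] (φ : M →ₗ[𝕜] N)
    (m : Fin n → Fin n → Fin n → Fin n → M) (c : RelIndex n) :
    φ (relator q r m c) = relator q r (fun i j k l => φ (m i j k l)) c := by
  cases c <;> simp only [relator, map_sub, map_add, map_smul, map_sum]

/-- The coordinate function of a monomial. -/
def indicator (𝕜 : Type*) [Field 𝕜] (x : Fin n × Fin n × Fin n × Fin n) (i j k l : Fin n) : 𝕜 :=
  if (i, j, k, l) = x then 1 else 0

theorem relator_indicator_relLead (hq : q ≠ 0) (hr : ∀ i j, i < j → r i j ≠ 0) (c : RelIndex n) :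
    relator q r (indicator 𝕜 (relLead c)) c ≠ 0 := by
  have hc {i j k : Fin n} (hij : i ≠ j) (hjk : j ≠ k) (hik : i ≠ k) : cocycleBar q r i j k ≠ 0 := by
    rw [cocycleBar_eq hq hr hij hjk hik]
    exact mul_ne_zero (mul_ne_zero (coeffM_ne_zero hq hr _ _) (coeffM_ne_zero hq hr _ _))
      (coeffM_ne_zero hq hr _ _)
  cases c with
  | i i k h => simp [relator, indicator, relLead, h.ne]
  | iia i k l hkl hk hl => simp [relator, indicator, relLead, hk.ne, hk.ne']
  | iib i k l hkl hk hl => simp [relator, indicator, relLead, hk.ne, hk.ne']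
  | iic i k l hl hk => simp [relator, indicator, relLead, hk.ne, hk.ne', hl.ne, hl.ne']
  | iid i k l hk hl => simp [relator, indicator, relLead, hk.ne, hk.ne', hl.ne, hl.ne']
  | iie i l h => simp [relator, indicator, relLead, h.ne, h.ne', hq]
  | iif i l h => simp [relator, indicator, relLead, h.ne, h.ne']
  | iig i k h => simp [relator, indicator, relLead, h.ne, h.ne']
  | iih i k h => simp [relator, indicator, relLead, h.ne, h.ne']
  | iiia i j k l hij hil hjk hjl hkl h =>
    simp [relator, indicator, relLead, h.ne, h.ne']
  | iiib i j l hij hil h => simp [relator, indicator, relLead, h.ne, h.ne', hq]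
  | iiic i j k hij hjk h => simp [relator, indicator, relLead, h.ne, h.ne']
  | iiid i j l hil hjl h =>
    simp [relator, indicator, relLead, h.ne, h.ne', hjl, hc hjl hil.symm h.ne']
  | iiie i j k hij hjk h =>
    simp [relator, indicator, relLead, h.ne, h.ne', hij, hc hij hjk h.ne]
  | iiif i j h =>
    -- A term of the double sum equal to the leading monomial would have `a = j`, against `a < i <
    -- j`.
    have e : ∀ b ∈ Finset.Iio j, ∀ a ∈ Finset.Iio i, q ^ (2 * ((a : ℤ) - (i : ℤ))) •
        indicator 𝕜 (relLead (.iiif i j h)) a b b a = 0 := by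
      intro b _ a ha
      rw [indicator, if_neg, smul_zero]
      simp only [relLead, Prod.mk.injEq]
      rintro ⟨rfl, -⟩
      exact absurd (Finset.mem_Iio.1 ha) h.not_gt
    rw [relator, Finset.sum_eq_zero fun b hb => Finset.sum_eq_zero fun a ha => e b hb a ha]
    simp [indicator, relLead, h.ne, h.ne']

end

theorem linearIndependent_relator {q : 𝕜} {r : Fin n → Fin n → 𝕜} (hq : q ≠ 0)
    (hr : ∀ i j, i < j → r i j ≠ 0) : LinearIndependent 𝕜 (relator q r (XX 𝕜)) := by
  have h (x : Fin n × Fin n × Fin n × Fin n) (c : RelIndex n) :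
      onBasis (indicator 𝕜 x) (relator q r (XX 𝕜) c) = relator q r (indicator 𝕜 x) c := by
    rw [map_relator]
    simp only [XX, onBasis_apply]
  refine linearIndependent_of_triangular _ (fun c => onBasis (indicator 𝕜 (relLead c))) relLevel
    (fun c => ?_) fun c c' hne hlv => ?_
  · rw [h]; exact relator_indicator_relLead hq hr c
  · rw [h]
    refine relator_eq_zero_of_occurs fun i j k l ho => if_neg ?_
    intro he
    rw [he] at ho
    rcases eq_of_relOccurs_relLead ho with h | h
    · exact hne h
    · omega

/-! ### The braided enveloping algebra -/

theorem quad_XX (i j k l : Fin n) : quad 𝕜 n (XX 𝕜 i j k l) =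
    TensorAlgebra.ι 𝕜 (X 𝕜 i j) * TensorAlgebra.ι 𝕜 (X 𝕜 k l) := by
  simp [quad, XX]

section

variable {q : 𝕜} {r : Fin n → Fin n → 𝕜} (hq : q ≠ 0) (hr : ∀ i j, i < j → r i j ≠ 0)
include hq hr

theorem comp_id_sub_Upsilon_heckeR_eq_zero_iff {M : Type*} [AddCommGroup M] [Module 𝕜 M]
    (φ : L 𝕜 n ⊗[𝕜] L 𝕜 n →ₗ[𝕜] M) :
    φ ∘ₗ (LinearMap.id - Upsilon (heckeR q r)) = 0 ↔
      ∀ c, relator q r (fun i j k l => φ (XX 𝕜 i j k l)) c = 0 := by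
  rw [comp_id_sub_Upsilon_eq_zero_iff (isUnit_det_heckeR hq hr)
    (isUnit_det_transpose₂_heckeR hq hr), breflects_iff_relator hq hr]

/-- The two subspaces are killed by the same linear maps. Testing this on the quotient map of each
one gives the two inclusions. -/
theorem span_relator : Submodule.span 𝕜 (Set.range (relator q r (XX 𝕜))) =
    LinearMap.range
      ((LinearMap.id : L 𝕜 n ⊗[𝕜] L 𝕜 n →ₗ[𝕜] L 𝕜 n ⊗[𝕜] L 𝕜 n) - Upsilon (heckeR q r)) := by
  apply le_antisymm
  · rw [Submodule.span_le]
    rintro _ ⟨c, rfl⟩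
    have h := (comp_id_sub_Upsilon_heckeR_eq_zero_iff hq hr (LinearMap.range
      ((LinearMap.id : L 𝕜 n ⊗[𝕜] L 𝕜 n →ₗ[𝕜] _) - Upsilon (heckeR q r))).mkQ).1
        (LinearMap.range_mkQ_comp _) c
    rwa [← map_relator, Submodule.mkQ_apply, Submodule.Quotient.mk_eq_zero] at h
  · have h := (comp_id_sub_Upsilon_heckeR_eq_zero_iff hq hr
      (Submodule.span 𝕜 (Set.range (relator q r (XX 𝕜)))).mkQ).2 fun c => by
        rw [← map_relator, Submodule.mkQ_apply, Submodule.Quotient.mk_eq_zero]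
        exact Submodule.subset_span ⟨c, rfl⟩
    rw [← LinearMap.range_le_ker_iff, Submodule.ker_mkQ] at h
    exact h

theorem relator_envX (c : RelIndex n) :
    relator q r (fun i j k l => envX (heckeR q r) i j * envX (heckeR q r) k l) c = 0 := by
  have h := (comp_id_sub_Upsilon_heckeR_eq_zero_iff hq hr
    ((RingQuot.mkAlgHom 𝕜 (EnvRel (heckeR q r))).toLinearMap ∘ₗ quad 𝕜 n)).1 (by
      refine LinearMap.ext fun t => ?_
      have := RingQuot.mkAlgHom_rel 𝕜 (s := EnvRel (heckeR q r)) ⟨t, rfl, rfl⟩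
      simpa using this) c
  simp only [LinearMap.comp_apply, AlgHom.toLinearMap_apply, quad_XX, map_mul] at h
  exact h

/-- Uniqueness is automatic, since the `envX` generate. Existence means that the induced map on
`T(L)` kills `im (id - Υ)` in degree two, which the relators detect. -/
theorem existsUnique_lift_iff {A : Type*} [Ring A] [Algebra 𝕜 A] (Y : Fin n → Fin n → A) :
    (∃! f : Env (heckeR q r) →ₐ[𝕜] A, ∀ i j, f (envX (heckeR q r) i j) = Y i j) ↔
      ∀ c, relator q r (fun i j k l => Y i j * Y k l) c = 0 := by
  constructor
  · rintro ⟨f, hf, -⟩ c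
    have h := congrArg f.toLinearMap (relator_envX hq hr c)
    rw [map_relator] at h
    simpa [hf] using h
  · intro H
    let g : L 𝕜 n →ₗ[𝕜] A := (Pi.basisFun 𝕜 (Fin n × Fin n)).constr 𝕜 fun x => Y x.1 x.2
    have hg (i j : Fin n) : g (X 𝕜 i j) = Y i j := by
      have := (Pi.basisFun 𝕜 (Fin n × Fin n)).constr_basis 𝕜 (fun x => Y x.1 x.2) (i, j)
      rwa [Pi.basisFun_apply] at this
    have hφ := (comp_id_sub_Upsilon_heckeR_eq_zero_iff hq hr
      ((TensorAlgebra.lift 𝕜 g).toLinearMap ∘ₗ quad 𝕜 n)).2 (by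
        simpa only [LinearMap.comp_apply, AlgHom.toLinearMap_apply, quad_XX, map_mul,
          TensorAlgebra.lift_ι_apply, hg] using H)
    have hrel : ∀ ⦃x y⦄, EnvRel (heckeR q r) x y →
        TensorAlgebra.lift 𝕜 g x = TensorAlgebra.lift 𝕜 g y := by
      rintro _ _ ⟨t, rfl, rfl⟩
      rw [map_zero]
      exact LinearMap.congr_fun hφ t
    refine ⟨RingQuot.liftAlgHom 𝕜 ⟨TensorAlgebra.lift 𝕜 g, hrel⟩, fun i j => ?_, fun f hf => ?_⟩
    · rw [envX, RingQuot.liftAlgHom_mkAlgHom_apply, TensorAlgebra.lift_ι_apply, hg]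
    · refine RingQuot.ringQuot_ext' _ _ _ (TensorAlgebra.hom_ext ?_)
      refine (Pi.basisFun 𝕜 (Fin n × Fin n)).ext fun x => ?_
      have h1 : (Pi.basisFun 𝕜 (Fin n × Fin n)) x = X 𝕜 x.1 x.2 := Pi.basisFun_apply _ _ _
      have h2 := hf x.1 x.2
      rw [envX] at h2
      simp only [h1, LinearMap.comp_apply, AlgHom.toLinearMap_apply, AlgHom.comp_apply, h2,
        RingQuot.liftAlgHom_mkAlgHom_apply, TensorAlgebra.lift_ι_apply, hg]

end

end BraidedMatrix

end

open BraidedMatrix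

theorem mainTheorem11 {𝕜 : Type*} [Field 𝕜] (n : ℕ) (q : 𝕜) (hq : q ≠ 0)
    (r : Fin n → Fin n → 𝕜) (hr : ∀ i j, i < j → r i j ≠ 0) :
    -- `R` and `R^{t₂}` are invertible, so that `R⁻¹` and `R̃` are genuine inverses
    IsUnit (heckeR q r).det ∧
    IsUnit (transpose₂ (heckeR q r)).det ∧
    -- the explicit formula for the canonical braiding
    (∀ i j k l : Fin n,
      Upsilon (heckeR q r) (XX 𝕜 i j k l) =
        ∑ m, ∑ s, ∑ o, ∑ p, ∑ a, ∑ b, ∑ c, ∑ d,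
          (ent (heckeR q r)⁻¹ a m i b *
            ent (heckeR q r) s c b o *
            ent (heckeR q r) p d c l *
            ent (secondInv (heckeR q r)) d j k a) •
          XX 𝕜 m s o p) ∧
    -- the listed quadratic elements form a basis of `im (id - Υ)`, and there are `n² choose 2`
    LinearIndependent 𝕜 (relator q r (XX 𝕜)) ∧
    Submodule.span 𝕜 (Set.range (relator q r (XX 𝕜))) =
      LinearMap.range
        ((LinearMap.id : L 𝕜 n ⊗[𝕜] L 𝕜 n →ₗ[𝕜] L 𝕜 n ⊗[𝕜] L 𝕜 n) - Upsilon (heckeR q r)) ∧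
    Nat.card (RelIndex n) = (n ^ 2).choose 2 ∧
    -- the listed relations hold in `B(L)`
    (∀ c, relator q r (fun i j k l => envX (heckeR q r) i j * envX (heckeR q r) k l) c = 0) ∧
    -- and they are defining relations of `B(L)` and of the algebra of braided matrices
    (∀ (A : Type*) [Ring A] [Algebra 𝕜 A] (Y : Fin n → Fin n → A),
      ((∃! f : Env (heckeR q r) →ₐ[𝕜] A,
          ∀ i j, f (envX (heckeR q r) i j) = Y i j) ↔
        ∀ c, relator q r (fun i j k l => Y i j * Y k l) c = 0) ∧
      (Reflection (heckeR q r) (Matrix.of Y) ↔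
        ∀ c, relator q r (fun i j k l => Y i j * Y k l) c = 0)) := by
  have hR := isUnit_det_heckeR hq hr
  have hR' := isUnit_det_transpose₂_heckeR hq hr
  refine ⟨hR, hR', Upsilon_XX hR hR', linearIndependent_relator hq hr, span_relator hq hr,
    card_relIndex n, relator_envX hq hr, fun A _ _ Y => ⟨existsUnique_lift_iff hq hr Y, ?_⟩⟩
  rw [reflection_iff, breflects_iff_relator hq hr]
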